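/- Let $n\in\mathbb N$, let $\operatorname{Sym}_n$ be the space of real symmetric $n\times n$ matrices and let $\operatorname{Sym}_n^+\subset\operatorname{Sym}_n$ be the manifold of symmetric positive definite (SPD) matrices, with tangent space $\operatorname{Sym}_n$ at every point. Consider on $\operatorname{Sym}_n^+$ one of the following three Riemannian metrics, indexed by $g\in\{le,lc,ai\}$, where $\langle A,B\rangle_F=\operatorname{tr}(A^TB)$: - (Log-Euclidean) $\langle V,W\rangle^{le}_P=\langle D\log_P(V),D\log_P(W)\rangle_F$, where $\log$ is the matrix logarithm and $D\log_P(V)$ its directional derivative at $P$ along $V$; - (Log-Cholesky) $\langle V,W\rangle^{lc}_P=\sum_{i>j}\widetilde V_{ij}\widetilde W_{ij}+\sum_i L_{ii}^{-2}\,\widetilde V_{ii}\widetilde W_{ii}$, where $L$ is the Cholesky factor of $P$ (lower triangular with positive diagonal, $P=LL^T$) and $\widetilde V=L\,(L^{-1}VL^{-T})_{\frac12}$, with $Y_{\frac12}$ the lower triangular part of $Y$ with its diagonal entries halved; - (Affine-Invariant) $\langle V,W\rangle^{ai}_P=\operatorname{tr}(P^{-1}VP^{-1}W)$. Let $\operatorname{Exp}^g_P$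 and $\operatorname{Log}^g_P$ be the Riemannian exponential and logarithmic maps at $P$, and let $\mathcal T^g_{P\to Q}$ be the parallel transport (of the Levi-Civita connection) along the geodesic from $P$ to $Q$. With $I_n$ the identity matrix, define for $P,Q,R\in\operatorname{Sym}_n^+$ $$P\oplus_g Q=\operatorname{Exp}^g_P\big(\mathcal T^g_{I_n\to P}(\operatorname{Log}^g_{I_n}(Q))\big),$$ let $\ominus_g P$ be the left inverse of $P$, i.e. $\ominus_g P\oplus_g P=I_n$, and define the gyroautomorphisms $$\operatorname{gyr}_g[P,Q]R=\big(\ominus_g(P\oplus_g Q)\big)\oplus_g\big(P\oplus_g(Q\oplus_g R)\big).$$ Let $\langle P,Q\rangle=\langle\operatorname{Log}^g_{I_n}(P),\operatorname{Log}^g_{I_n}(Q)\rangle^g_{I_n}$ be the SPD inner product, $\|P\|=\sqrt{\langle P,P\rangle}$ the SPD norm, and $d(P,Q)=\|\ominus_g P\oplus_g Q\|$ the SPD gyrodistance. **Theorem.** For every $g\in\{le,lc,ai\}$ and all $P,Q\in\operatorname{Sym}_n^+$, the map $\operatorname{gyr}_g[P,Q]:\operatorname{Sym}_n^+\to\operatorname{Sym}_n^+$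 is an SPD gyroisometry: for all $R,S\in\operatorname{Sym}_n^+$, $$d\big(\operatorname{gyr}_g[P,Q]R,\operatorname{gyr}_g[P,Q]S\big)=d(R,S).$$ -/

import Mathlib

open Matrix

noncomputable section

namespace SPDGyro

/-! Riemannian geometry of the open set of symmetric positive definite (SPD) matrices inside the
vector space of symmetric matrices, in its global linear chart. -/

/-- Real square matrices of size `n`. -/
abbrev Mat (n : ℕ) : Type := Matrix (Fin n) (Fin n) ℝ

/-- The space of real symmetric matrices, which is the tangent space of `SPD n` at every point. -/
abbrev Sym (n : ℕ) : Type := {A : Mat n // A.IsSymm}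

/-- The manifold of real symmetric positive definite matrices
(`Matrix.PosDef` over `ℝ` includes symmetry). -/
abbrev SPD (n : ℕ) : Type := {P : Mat n // P.PosDef}

instance (n : ℕ) : Nonempty (Sym n) := ⟨⟨1, Matrix.isSymm_one⟩⟩

/-- The identity matrix as a point of `SPD n`. -/
def one (n : ℕ) : SPD n := ⟨1, Matrix.PosDef.one⟩

instance (n : ℕ) : Nonempty (SPD n) := ⟨one n⟩

/-- The Frobenius inner product `∑ i j, A i j * B i j`. -/
def frob {n : ℕ} (A B : Mat n) : ℝ := (Aᵀ * B).trace

/-! ### The three metrics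

A metric is written as a function `g P V W`; only its values at SPD matrices `P` and symmetric
matrices `V`, `W` matter. -/

/-- The matrix logarithm of a symmetric matrix, through the spectral functional calculus. -/
def logm {n : ℕ} (P : Mat n) : Mat n := cfc Real.log P

/-- The directional derivative of the matrix logarithm at `P` along `W`. -/
def Dlogm {n : ℕ} (P W : Mat n) : Mat n := deriv (fun t : ℝ => logm (P + t • W)) 0

/-- The Log-Euclidean metric. -/
def metricLE {n : ℕ} (P V W : Mat n) : ℝ := frob (Dlogm P V) (Dlogm P W)

/-- `L` is a Cholesky factor of `P`: it is lower triangular with positive diagonal entries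
and `P = L Lᵀ`. -/
def IsCholesky {n : ℕ} (L P : Mat n) : Prop :=
  (∀ i j, i < j → L i j = 0) ∧ (∀ i, 0 < L i i) ∧ P = L * Lᵀ

/-- The Cholesky factor (it exists and is unique for an SPD matrix). -/
def cholesky {n : ℕ} (P : Mat n) : Mat n := Classical.epsilon fun L => IsCholesky L P

/-- The lower triangular part of a matrix, with the diagonal entries halved. -/
def lowerHalf {n : ℕ} (Y : Mat n) : Mat n :=
  Matrix.of fun i j => if j < i then Y i j else if i = j then Y i i / 2 else 0

/-- The Riemannian metric on lower triangular matrices `L` with positive diagonal entries: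
Frobenius on the strictly lower triangular part, and `L i i ^ (-2)`-weighted on the diagonal. -/
def metricLower {n : ℕ} (L X Y : Mat n) : ℝ :=
  (∑ i, ∑ j, if j < i then X i j * Y i j else 0) + ∑ i, X i i * Y i i / (L i i) ^ 2

/-- The differential at `P` of the map sending an SPD matrix to its Cholesky factor. -/
def Dcholesky {n : ℕ} (P W : Mat n) : Mat n :=
  cholesky P * lowerHalf ((cholesky P)⁻¹ * W * ((cholesky P)⁻¹)ᵀ)

/-- The Log-Cholesky metric. -/
def metricLC {n : ℕ} (P V W : Mat n) : ℝ :=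
  metricLower (cholesky P) (Dcholesky P V) (Dcholesky P W)

/-- The Affine-Invariant metric, `⟨P^(-1/2) V P^(-1/2), P^(-1/2) W P^(-1/2)⟩_F`
written as `tr (P⁻¹ V P⁻¹ W)`. -/
def metricAI {n : ℕ} (P V W : Mat n) : ℝ := (P⁻¹ * V * P⁻¹ * W).trace

/-- The index set of the metrics: Log-Euclidean, Log-Cholesky, Affine-Invariant. -/
inductive Geometry where
  | le : Geometry
  | lc : Geometry
  | ai : Geometry

/-- The Riemannian metric of each of the three geometries. -/
def metric {n : ℕ} : Geometry → Mat n → Mat n → Mat n → ℝ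
  | Geometry.le => metricLE
  | Geometry.lc => metricLC
  | Geometry.ai => metricAI

/-! ### Levi-Civita connection, geodesics, exponential map, parallel transport -/

/-- The derivative `∂_U (g(V, W))` at `P` of the metric coefficient `P ↦ g P V W`
along the constant field `U`. -/
def metricDeriv {n : ℕ} (g : Mat n → Mat n → Mat n → ℝ) (P U V W : Mat n) : ℝ :=
  deriv (fun t : ℝ => g (P + t • U) V W) 0

/-- The Christoffel symbol of the first kind: the Levi-Civita connection of `g` satisfies
`g(∇_U V, Z) = christoffel g P U V Z` for constant fields `U`, `V`, `Z`. -/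
def christoffel {n : ℕ} (g : Mat n → Mat n → Mat n → ℝ) (P U V Z : Mat n) : ℝ :=
  (metricDeriv g P U V Z + metricDeriv g P V U Z - metricDeriv g P Z U V) / 2

/-- `u` is the velocity field of the curve `γ`. -/
def IsVelocity {n : ℕ} (γ : ℝ → SPD n) (u : ℝ → Sym n) : Prop :=
  ∀ t, HasDerivAt (fun s => (γ s : Mat n)) (u t : Mat n) t

/-- The vector field `V` along the curve `γ` with velocity `u` is differentiable and parallel:
its covariant derivative `V' + Γ_γ(u, V)` vanishes, that is, is `g`-orthogonal to every
tangent vector `Z`. -/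
def IsParallel {n : ℕ} (g : Mat n → Mat n → Mat n → ℝ) (γ : ℝ → SPD n) (u V : ℝ → Sym n) : Prop :=
  ∀ t, ∃ V' : Sym n, HasDerivAt (fun s => (V s : Mat n)) (V' : Mat n) t ∧
    ∀ Z : Sym n, g (γ t) V' Z + christoffel g (γ t) (u t) (V t) Z = 0

/-- `γ` is a geodesic with velocity `u`: its velocity is parallel along it. -/
def IsGeodesic {n : ℕ} (g : Mat n → Mat n → Mat n → ℝ) (γ : ℝ → SPD n) (u : ℝ → Sym n) : Prop :=
  IsVelocity γ u ∧ IsParallel g γ u u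

/-- The exponential map `Exp_P(W)`: the value at time `1` of the geodesic starting at `P` with
initial velocity `W` (the three geometries are geodesically complete). -/
def Exp {n : ℕ} (g : Mat n → Mat n → Mat n → ℝ) (P : SPD n) (W : Sym n) : SPD n :=
  Classical.epsilon fun Q => ∃ γ u, IsGeodesic g γ u ∧ γ 0 = P ∧ u 0 = W ∧ γ 1 = Q

/-- The logarithmic map `Log_P(Q)`: the tangent vector `W` at `P` with `Exp_P(W) = Q`
(for the three geometries `Exp_P` is a bijection). -/
def Log {n : ℕ} (g : Mat n → Mat n → Mat n → ℝ) (P Q : SPD n) : Sym n :=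
  Classical.epsilon fun W => Exp g P W = Q

/-- The parallel transport `T_{P → Q}(W)` of `W` along the geodesic from `P` to `Q`. -/
def transport {n : ℕ} (g : Mat n → Mat n → Mat n → ℝ) (P Q : SPD n) (W : Sym n) : Sym n :=
  Classical.epsilon fun W' => ∃ γ u V, IsGeodesic g γ u ∧ γ 0 = P ∧ γ 1 = Q ∧
    IsParallel g γ u V ∧ V 0 = W ∧ V 1 = W'

/-! ### The gyro-structure -/

/-- The binary operation `P ⊕ Q = Exp_P (T_{I → P} (Log_I Q))`. -/
def oplus {n : ℕ} (g : Geometry) (P Q : SPD n) : SPD n :=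
  Exp (metric g) P (transport (metric g) (one n) P (Log (metric g) (one n) Q))

/-- The left inverse `⊖ Y`, with `⊖ Y ⊕ Y = I`. -/
def ominus {n : ℕ} (g : Geometry) (Y : SPD n) : SPD n :=
  Classical.epsilon fun X => oplus g X Y = one n

/-- The gyroautomorphism `gyr[P, Q] R = (⊖ (P ⊕ Q)) ⊕ (P ⊕ (Q ⊕ R))`. -/
def gyr {n : ℕ} (g : Geometry) (P Q R : SPD n) : SPD n :=
  oplus g (ominus g (oplus g P Q)) (oplus g P (oplus g Q R))

/-- The SPD inner product `⟨P, Q⟩ = ⟨Log_I P, Log_I Q⟩_I`. -/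
def spdInner {n : ℕ} (g : Geometry) (P Q : SPD n) : ℝ :=
  metric g (one n : Mat n) (Log (metric g) (one n) P) (Log (metric g) (one n) Q)

/-- The SPD norm. -/
def spdNorm {n : ℕ} (g : Geometry) (P : SPD n) : ℝ := Real.sqrt (spdInner g P P)

/-- The SPD gyrodistance `d(P, Q) = ‖⊖ P ⊕ Q‖`. -/
def gyrodist {n : ℕ} (g : Geometry) (P Q : SPD n) : ℝ := spdNorm g (oplus g (ominus g P) Q)

/-- An SPD gyroisometry is a self-map of `SPD n` preserving the SPD gyrodistance. -/
def IsGyroisometry {n : ℕ} (g : Geometry) (ω : SPD n → SPD n) : Prop :=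
  ∀ P Q : SPD n, gyrodist g (ω P) (ω Q) = gyrodist g P Q

end SPDGyro

end

/-! The Log-Euclidean and the Log-Cholesky metric are flat: the matrix logarithm, and the Cholesky
factor with the logarithm taken on its diagonal, are global charts in which the metric is constant,
so that geodesics are affine and parallel transport is the identity. In such a chart `⊕` is
addition, hence `gyr[P, Q]` is the identity.

For the Affine-Invariant metric, the geodesics and the parallel fields along them solve a linear
equation `X' = B X + X Bᵀ` with `B` constant along the geodesic. This gives
`P ⊕ Q = √P Q √P`, so `gyr[P, Q]` is the conjugation `R ↦ O R Oᵀ` by `O = √(⊖ (P ⊕ Q)) √P √Q`. The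
matrix `O` is orthogonal because `(⊖ (P ⊕ Q)) ⊕ (P ⊕ Q) = I`, and conjugation by an orthogonal
matrix commutes with `⊕` and `⊖` and preserves the norm. -/

noncomputable section

namespace SPDGyro

open Filter Topology NormedSpace
open scoped Matrix.Norms.L2Operator MatrixOrder

/-! ### Smooth left inverses -/

section LeftInverse

variable {E F : Type*} [NormedAddCommGroup E] [NormedSpace ℝ E] [CompleteSpace E]
  [NormedAddCommGroup F] [NormedSpace ℝ F] {Ψ : E → F} {Φ : F → E} {e : E ≃L[ℝ] F} {x : E}

theorem eventually_rightInverse_of_leftInverse (hΦ : Function.LeftInverse Φ Ψ)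
    (hΨ : HasStrictFDerivAt Ψ (e : E →L[ℝ] F) x) : ∀ᶠ q in 𝓝 (Ψ x), Ψ (Φ q) = q := by
  filter_upwards [hΨ.eventually_right_inverse] with q hq
  rw [← hq, hΦ]

theorem contDiffAt_of_leftInverse (hΦ : Function.LeftInverse Φ Ψ) {k : WithTop ℕ∞} (hk : k ≠ 0)
    (hΨ : ContDiffAt ℝ k Ψ x) (he : HasFDerivAt Ψ (e : E →L[ℝ] F) x) :
    ContDiffAt ℝ k Φ (Ψ x) := by
  refine (hΨ.to_localInverse he hk).congr_of_eventuallyEq ?_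
  filter_upwards [(hΨ.hasStrictFDerivAt' he hk).eventually_right_inverse] with q hq
  conv_lhs => rw [← hq, hΦ]
  rfl

end LeftInverse

theorem hasDerivAt_comp_clm_apply {E F G : Type*} [NormedAddCommGroup E] [NormedSpace ℝ E]
    [NormedAddCommGroup F] [NormedSpace ℝ F] [NormedAddCommGroup G] [NormedSpace ℝ G]
    {D : E → F →L[ℝ] G} {D' : E →L[ℝ] F →L[ℝ] G} {x : ℝ → E} {x' : E} {v : ℝ → F} {v' : F} {t : ℝ}
    (hD : HasFDerivAt D D' (x t)) (hx : HasDerivAt x x' t) (hv : HasDerivAt v v' t) :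
    HasDerivAt (fun s => D (x s) (v s)) (D' x' (v t) + D (x t) v') t :=
  (hD.comp_hasDerivAt t hx).clm_apply hv

theorem hasDerivAt_add_smul {E : Type*} [NormedAddCommGroup E] [NormedSpace ℝ E] (x v : E) (t : ℝ) :
    HasDerivAt (fun s : ℝ => x + s • v) v t := by
  simpa using ((hasDerivAt_id t).smul_const v).const_add x

variable {n : ℕ}

/-! ### Curves of matrices -/

theorem hasDerivAt_transpose {f : ℝ → Mat n} {f' : Mat n} {t : ℝ} (hf : HasDerivAt f f' t) :
    HasDerivAt (fun s => (f s)ᵀ) f'ᵀ t :=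
  (starL' ℝ : Mat n ≃L[ℝ] Mat n).hasFDerivAt.comp_hasDerivAt t hf

theorem isSymm_of_hasDerivAt {f : ℝ → Mat n} {f' : Mat n} {t : ℝ} (hf : HasDerivAt f f' t)
    (hsymm : ∀ s, (f s).IsSymm) : f'.IsSymm := by
  have hf' := hasDerivAt_transpose hf
  rw [show (fun s => (f s)ᵀ) = f from funext hsymm] at hf'
  exact hf'.unique hf

theorem isSymm_add_smul {A B : Mat n} (hA : A.IsSymm) (hB : B.IsSymm) (t : ℝ) :
    (A + t • B).IsSymm :=
  hA.add (hB.smul t)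

theorem isSymm_fderiv {f : Mat n → Mat n} (hf : ∀ A, A.IsSymm → (f A).IsSymm) {A B : Mat n}
    (hA : A.IsSymm) (hB : B.IsSymm) : (fderiv ℝ f A B).IsSymm := by
  by_cases hd : DifferentiableAt ℝ f A
  · exact isSymm_of_hasDerivAt (hd.hasFDerivAt.hasLineDerivAt B)
      fun t => hf _ (isSymm_add_smul hA hB t)
  · simp [fderiv_zero_of_not_differentiableAt hd, isSymm_zero]

theorem posDef_isSymm {P : Mat n} (hP : P.PosDef) : P.IsSymm :=
  isHermitian_iff_isSymm.1 hP.isHermitian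

/-! ### Extension of maps of symmetric matrices -/

/-- The projection onto the symmetric matrices along the skew-symmetric ones. -/
def symmPart (n : ℕ) : Mat n →L[ℝ] Mat n :=
  (selfAdjoint.submodule ℝ (Mat n)).subtypeL ∘L selfAdjointPartL ℝ (Mat n)

theorem isSymm_symmPart (A : Mat n) : (symmPart n A).IsSymm :=
  isHermitian_iff_isSymm.1 (selfAdjointPart ℝ A).2

theorem symmPart_of_isSymm {A : Mat n} (hA : A.IsSymm) : symmPart n A = A :=
  (isHermitian_iff_isSymm.2 hA).isSelfAdjoint.coe_selfAdjointPart_apply ℝ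

theorem symmPart_symmPart (A : Mat n) : symmPart n (symmPart n A) = symmPart n A :=
  symmPart_of_isSymm (isSymm_symmPart A)

/-- The extension of a map of symmetric matrices by the identity on skew-symmetric parts. It turns
a diffeomorphism between sets of symmetric matrices into one between open sets of `Mat n`. -/
def extendSymm (f : Mat n → Mat n) (A : Mat n) : Mat n := f (symmPart n A) + (A - symmPart n A)

theorem extendSymm_of_isSymm (f : Mat n → Mat n) {A : Mat n} (hA : A.IsSymm) :
    extendSymm f A = f A := by
  rw [extendSymm, symmPart_of_isSymm hA, sub_self, add_zero]

theorem symmPart_extendSymm {f : Mat n → Mat n} {A : Mat n} (hf : (f (symmPart n A)).IsSymm) :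
    symmPart n (extendSymm f A) = f (symmPart n A) := by
  rw [extendSymm, map_add, map_sub, symmPart_of_isSymm hf, symmPart_symmPart, sub_self, add_zero]

theorem leftInverse_extendSymm {f g : Mat n → Mat n} (hf : ∀ A, A.IsSymm → (f A).IsSymm)
    (hgf : ∀ A, A.IsSymm → g (f A) = A) :
    Function.LeftInverse (extendSymm g) (extendSymm f) := fun A => by
  have hA := isSymm_symmPart A
  rw [extendSymm, symmPart_extendSymm (hf _ hA), hgf _ hA, extendSymm]
  abel

theorem contDiff_extendSymm {f : Mat n → Mat n} {k : WithTop ℕ∞} (hf : ContDiff ℝ k f) :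
    ContDiff ℝ k (extendSymm f) :=
  (hf.comp (symmPart n).contDiff).add (contDiff_id.sub (symmPart n).contDiff)

theorem fderiv_extendSymm {f : Mat n → Mat n} {X : Mat n} (hX : X.IsSymm)
    (hf : DifferentiableAt ℝ f X) (V : Mat n) :
    fderiv ℝ (extendSymm f) X V = fderiv ℝ f X (symmPart n V) + (V - symmPart n V) := by
  have h1 : HasFDerivAt (fun A => f (symmPart n A)) (fderiv ℝ f X ∘L symmPart n) X := by
    refine HasFDerivAt.comp X ?_ (symmPart n).hasFDerivAt
    rw [symmPart_of_isSymm hX]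
    exact hf.hasFDerivAt
  have h2 := h1.add ((hasFDerivAt_id X).sub (symmPart n).hasFDerivAt)
  exact congrArg (· V) h2.fderiv

theorem fderiv_extendSymm_injective {f : Mat n → Mat n} (hf : ∀ A, A.IsSymm → (f A).IsSymm)
    {X : Mat n} (hX : X.IsSymm) (hd : DifferentiableAt ℝ f X)
    (hinj : ∀ V, V.IsSymm → fderiv ℝ f X V = 0 → V = 0) :
    Function.Injective (fderiv ℝ (extendSymm f) X) := by
  refine (injective_iff_map_eq_zero _).2 fun V hV => ?_
  rw [fderiv_extendSymm hX hd] at hV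
  have hsymm : fderiv ℝ f X (symmPart n V) = 0 := by
    have := congrArg (symmPart n) hV
    rwa [map_add, map_sub, symmPart_of_isSymm (isSymm_fderiv hf hX (isSymm_symmPart V)),
      symmPart_symmPart, sub_self, add_zero, map_zero] at this
  have hV0 := hinj _ (isSymm_symmPart V) hsymm
  rwa [hsymm, hV0, zero_add, sub_zero] at hV

/-! ### Global charts by symmetric matrices -/

/-- A bijection between the SPD matrices and the symmetric matrices whose inverse `param` is twice
continuously differentiable with injective differential, and which maps the identity to zero. -/
structure GlobalChart (n : ℕ) where
  /-- The coordinates of an SPD matrix. -/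
  chart : Mat n → Mat n
  /-- The SPD matrix with given coordinates. -/
  param : Mat n → Mat n
  isSymm_chart : ∀ P, (chart P).IsSymm
  posDef_param : ∀ X, X.IsSymm → (param X).PosDef
  chart_param : ∀ X, X.IsSymm → chart (param X) = X
  param_chart : ∀ P, P.PosDef → param (chart P) = P
  chart_one : chart 1 = 0
  contDiff_param : ContDiff ℝ 2 param
  eq_zero_of_fderiv_param : ∀ X V, X.IsSymm → V.IsSymm → fderiv ℝ param X V = 0 → V = 0

namespace GlobalChart

variable (c : GlobalChart n)

theorem isSymm_param {X : Mat n} (hX : X.IsSymm) : (c.param X).IsSymm :=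
  posDef_isSymm (c.posDef_param X hX)

theorem hasFDerivAt_param (X : Mat n) : HasFDerivAt c.param (fderiv ℝ c.param X) X :=
  (c.contDiff_param.differentiable two_ne_zero X).hasFDerivAt

theorem hasFDerivAt_fderiv_param (X : Mat n) :
    HasFDerivAt (fderiv ℝ c.param) (fderiv ℝ (fderiv ℝ c.param) X) X :=
  ((c.contDiff_param.fderiv_right (m := 1) le_rfl).differentiable one_ne_zero X).hasFDerivAt

theorem isSymm_fderiv_param {X V : Mat n} (hX : X.IsSymm) (hV : V.IsSymm) :
    (fderiv ℝ c.param X V).IsSymm :=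
  isSymm_fderiv (fun _ => c.isSymm_param) hX hV

theorem extendSymm_param_chart {P : Mat n} (hP : P.PosDef) :
    extendSymm c.param (c.chart P) = P := by
  rw [extendSymm_of_isSymm _ (c.isSymm_chart P), c.param_chart P hP]

theorem leftInverse_extendSymm_chart :
    Function.LeftInverse (extendSymm c.chart) (extendSymm c.param) :=
  leftInverse_extendSymm (fun _ => c.isSymm_param) c.chart_param

theorem exists_hasFDerivAt_extendSymm_param {X : Mat n} (hX : X.IsSymm) :
    ∃ e : Mat n ≃L[ℝ] Mat n, HasFDerivAt (extendSymm c.param) (e : Mat n →L[ℝ] Mat n) X :=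
  ⟨(LinearEquiv.ofInjectiveEndo (fderiv ℝ (extendSymm c.param) X).toLinearMap
      (fderiv_extendSymm_injective (fun _ => c.isSymm_param) hX
        (c.hasFDerivAt_param X).differentiableAt
        (c.eq_zero_of_fderiv_param X · hX))).toContinuousLinearEquiv,
    ((contDiff_extendSymm c.contDiff_param).differentiable two_ne_zero X).hasFDerivAt⟩

theorem contDiffAt_extendSymm_chart {P : Mat n} (hP : P.PosDef) :
    ContDiffAt ℝ 2 (extendSymm c.chart) P := by
  obtain ⟨e, he⟩ := c.exists_hasFDerivAt_extendSymm_param (c.isSymm_chart P)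
  have h := contDiffAt_of_leftInverse c.leftInverse_extendSymm_chart two_ne_zero
    (contDiff_extendSymm c.contDiff_param).contDiffAt he
  rwa [c.extendSymm_param_chart hP] at h

include c in
theorem eventually_posDef_add_smul {P U : Mat n} (hP : P.PosDef) (hU : U.IsSymm) :
    ∀ᶠ t : ℝ in 𝓝 0, (P + t • U).PosDef := by
  obtain ⟨e, he⟩ := c.exists_hasFDerivAt_extendSymm_param (c.isSymm_chart P)
  have h := eventually_rightInverse_of_leftInverse c.leftInverse_extendSymm_chart
    ((contDiff_extendSymm c.contDiff_param).contDiffAt.hasStrictFDerivAt' he two_ne_zero)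
  rw [c.extendSymm_param_chart hP] at h
  have hlim : Tendsto (fun t : ℝ => P + t • U) (𝓝 0) (𝓝 P) :=
    Continuous.tendsto' (by fun_prop) 0 P (by simp)
  filter_upwards [hlim.eventually h] with t ht
  rw [extendSymm_of_isSymm _ (isSymm_add_smul (posDef_isSymm hP) hU t),
    extendSymm_of_isSymm _ (c.isSymm_chart _)] at ht
  exact ht ▸ c.posDef_param _ (c.isSymm_chart _)

/-- The differential of the chart, extended to all matrices as in `extendSymm`. -/
def dchart (P : Mat n) : Mat n →L[ℝ] Mat n := fderiv ℝ (extendSymm c.chart) P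

theorem isSymm_dchart {P W : Mat n} (hP : P.IsSymm) (hW : W.IsSymm) : (c.dchart P W).IsSymm :=
  isSymm_fderiv (fun A hA => extendSymm_of_isSymm c.chart hA ▸ c.isSymm_chart A) hP hW

theorem hasFDerivAt_extendSymm_chart {P : Mat n} (hP : P.PosDef) :
    HasFDerivAt (extendSymm c.chart) (c.dchart P) P :=
  ((c.contDiffAt_extendSymm_chart hP).differentiableAt two_ne_zero).hasFDerivAt

theorem hasFDerivAt_dchart {P : Mat n} (hP : P.PosDef) :
    HasFDerivAt c.dchart (fderiv ℝ c.dchart P) P :=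
  (((c.contDiffAt_extendSymm_chart hP).fderiv_right (m := 1) le_rfl).differentiableAt
    one_ne_zero).hasFDerivAt

theorem fderiv_dchart_comm {P : Mat n} (hP : P.PosDef) (U V : Mat n) :
    fderiv ℝ c.dchart P U V = fderiv ℝ c.dchart P V U :=
  (c.contDiffAt_extendSymm_chart hP).isSymmSndFDerivAt (by simp) U V

theorem hasDerivAt_chart_add_smul {P W : Mat n} (hP : P.PosDef) (hW : W.IsSymm) :
    HasDerivAt (fun t : ℝ => c.chart (P + t • W)) (c.dchart P W) 0 := by
  have h := (c.hasFDerivAt_extendSymm_chart hP).hasLineDerivAt W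
  rwa [HasLineDerivAt, funext fun t =>
    extendSymm_of_isSymm c.chart (isSymm_add_smul (posDef_isSymm hP) hW t)] at h

theorem dchart_fderiv_param {P V : Mat n} (hP : P.PosDef) (hV : V.IsSymm) :
    c.dchart P (fderiv ℝ c.param (c.chart P) V) = V := by
  have hX := c.isSymm_chart P
  have hΦ : HasFDerivAt (extendSymm c.chart) (c.dchart P) (extendSymm c.param (c.chart P)) := by
    rw [c.extendSymm_param_chart hP]
    exact c.hasFDerivAt_extendSymm_chart hP
  have hΨ := ((contDiff_extendSymm c.contDiff_param).differentiable two_ne_zero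
    (c.chart P)).hasFDerivAt
  have h := hΦ.comp _ hΨ
  rw [c.leftInverse_extendSymm_chart.comp_eq_id] at h
  have := congrArg (· V) (h.unique (hasFDerivAt_id _))
  simpa [fderiv_extendSymm hX (c.hasFDerivAt_param _).differentiableAt, symmPart_of_isSymm hV]
    using this

theorem dchart_param_fderiv_param {X V : Mat n} (hX : X.IsSymm) (hV : V.IsSymm) :
    c.dchart (c.param X) (fderiv ℝ c.param X V) = V := by
  have h := c.dchart_fderiv_param (c.posDef_param X hX) hV
  rwa [c.chart_param X hX] at h

theorem fderiv_param_dchart {P W : Mat n} (hP : P.PosDef) (hW : W.IsSymm) :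
    fderiv ℝ c.param (c.chart P) (c.dchart P W) = W := by
  have h : HasDerivAt (fun t : ℝ => c.param (c.chart (P + t • W)))
      (fderiv ℝ c.param (c.chart P) (c.dchart P W)) 0 :=
    (by simpa using c.hasFDerivAt_param (c.chart P) :
      HasFDerivAt c.param (fderiv ℝ c.param (c.chart P))
        (c.chart (P + (0 : ℝ) • W))).comp_hasDerivAt 0 (c.hasDerivAt_chart_add_smul hP hW)
  refine h.unique (HasDerivAt.congr_of_eventuallyEq (f := fun t : ℝ => P + t • W) ?_ ?_)
  · exact hasDerivAt_add_smul P W 0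
  · filter_upwards [c.eventually_posDef_add_smul hP hW] with t ht using c.param_chart _ ht

theorem chart_injective : Function.Injective fun P : SPD n => c.chart P := fun P Q h =>
  Subtype.ext (by
    rw [← c.param_chart P P.2, ← c.param_chart Q Q.2, show c.chart P = c.chart Q from h])

theorem dchart_injective (P : SPD n) : Function.Injective fun W : Sym n => c.dchart P W :=
  fun V W h => Subtype.ext (by
    rw [← c.fderiv_param_dchart P.2 V.2, ← c.fderiv_param_dchart P.2 W.2,
      show c.dchart P V = c.dchart P W from h])

theorem hasDerivAt_chart {γ : ℝ → SPD n} {u : ℝ → Sym n} (hγ : IsVelocity γ u) (t : ℝ) :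
    HasDerivAt (fun s => c.chart (γ s)) (c.dchart (γ t) (u t)) t := by
  have h := (c.hasFDerivAt_extendSymm_chart (γ t).2).comp_hasDerivAt t (hγ t)
  rwa [show extendSymm c.chart ∘ (fun s => (γ s : Mat n)) = fun s => c.chart (γ s) from
    funext fun s => extendSymm_of_isSymm c.chart (posDef_isSymm (γ s).2)] at h

theorem hasDerivAt_dchart {γ : ℝ → SPD n} {u V : ℝ → Sym n} (hγ : IsVelocity γ u)
    {V' : Mat n} {t : ℝ} (hV : HasDerivAt (fun s => (V s : Mat n)) V' t) :
    HasDerivAt (fun s => c.dchart (γ s) (V s))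
      (fderiv ℝ c.dchart (γ t) (u t) (V t) + c.dchart (γ t) V') t :=
  hasDerivAt_comp_clm_apply (x := fun s => (γ s : Mat n)) (c.hasFDerivAt_dchart (γ t).2) (hγ t) hV

end GlobalChart

/-! ### Specifications of the Riemannian operations -/

section Specification

variable {g : Mat n → Mat n → Mat n → ℝ} {P Q : SPD n} {W : Sym n}

theorem exists_isGeodesic_Exp (h : ∃ γ u, IsGeodesic g γ u ∧ γ 0 = P ∧ u 0 = W) :
    ∃ γ u, IsGeodesic g γ u ∧ γ 0 = P ∧ u 0 = W ∧ γ 1 = Exp g P W := by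
  obtain ⟨γ, u, hγ, h0, hu0⟩ := h
  exact Classical.epsilon_spec
    (p := fun Q => ∃ γ u, IsGeodesic g γ u ∧ γ 0 = P ∧ u 0 = W ∧ γ 1 = Q)
    ⟨γ 1, γ, u, hγ, h0, hu0, rfl⟩

theorem Exp_Log (h : ∃ W, Exp g P W = Q) : Exp g P (Log g P Q) = Q :=
  Classical.epsilon_spec h

theorem exists_isParallel_transport
    (h : ∃ γ u V, IsGeodesic g γ u ∧ γ 0 = P ∧ γ 1 = Q ∧ IsParallel g γ u V ∧ V 0 = W) :
    ∃ γ u V, IsGeodesic g γ u ∧ γ 0 = P ∧ γ 1 = Q ∧ IsParallel g γ u V ∧ V 0 = W ∧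
      V 1 = transport g P Q W := by
  obtain ⟨γ, u, V, hγ, h0, h1, hV, hV0⟩ := h
  exact Classical.epsilon_spec
    (p := fun W' => ∃ γ u V, IsGeodesic g γ u ∧ γ 0 = P ∧ γ 1 = Q ∧ IsParallel g γ u V ∧
      V 0 = W ∧ V 1 = W')
    ⟨V 1, γ, u, V, hγ, h0, h1, hV, hV0, rfl⟩

theorem ominus_oplus {g : Geometry} (h : ∃ X, oplus g X P = one n) :
    oplus g (ominus g P) P = one n :=
  Classical.epsilon_spec h

end Specification

/-! ### Flat geometries -/

/-- In the coordinates of the chart `c`, the metric `g` is the constant bilinear form `form`, which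
is symmetric and definite on symmetric matrices. -/
structure GlobalChart.IsFlat (c : GlobalChart n) (g : Mat n → Mat n → Mat n → ℝ)
    (form : Mat n →L[ℝ] Mat n →L[ℝ] ℝ) : Prop where
  form_comm : ∀ X Y, form X Y = form Y X
  eq_zero_of_form_self : ∀ X, X.IsSymm → form X X = 0 → X = 0
  metric_param : ∀ X V W, X.IsSymm → V.IsSymm → W.IsSymm →
    g (c.param X) (fderiv ℝ c.param X V) (fderiv ℝ c.param X W) = form V W

namespace GlobalChart.IsFlat

section Metric

variable {c : GlobalChart n} {g : Mat n → Mat n → Mat n → ℝ} {form : Mat n →L[ℝ] Mat n →L[ℝ] ℝ}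
  (h : c.IsFlat g form)

include h

theorem metric_eq {P V W : Mat n} (hP : P.PosDef) (hV : V.IsSymm) (hW : W.IsSymm) :
    g P V W = form (c.dchart P V) (c.dchart P W) := by
  have hP' := posDef_isSymm hP
  have := h.metric_param (c.chart P) _ _ (c.isSymm_chart P) (c.isSymm_dchart hP' hV)
    (c.isSymm_dchart hP' hW)
  rwa [c.param_chart P hP, c.fderiv_param_dchart hP hV, c.fderiv_param_dchart hP hW] at this

theorem metricDeriv_eq {P U V W : Mat n} (hP : P.PosDef) (hU : U.IsSymm) (hV : V.IsSymm)
    (hW : W.IsSymm) :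
    metricDeriv g P U V W = form (fderiv ℝ c.dchart P U V) (c.dchart P W) +
      form (c.dchart P V) (fderiv ℝ c.dchart P U W) := by
  have hD (X : Mat n) :
      HasDerivAt (fun t : ℝ => c.dchart (P + t • U) X) (fderiv ℝ c.dchart P U X) 0 := by
    have hP₀ : HasFDerivAt c.dchart (fderiv ℝ c.dchart P) (P + (0 : ℝ) • U) := by
      simpa using c.hasFDerivAt_dchart hP
    simpa using hasDerivAt_comp_clm_apply hP₀ (hasDerivAt_add_smul P U 0) (hasDerivAt_const 0 X)
  have hform := hasDerivAt_comp_clm_apply form.hasFDerivAt (hD V) (hD W)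
  simp only [zero_smul, add_zero] at hform
  refine (hform.congr_of_eventuallyEq ?_).deriv
  filter_upwards [c.eventually_posDef_add_smul hP hU] with t ht
  exact h.metric_eq ht hV hW

theorem christoffel_eq {P U V Z : Mat n} (hP : P.PosDef) (hU : U.IsSymm) (hV : V.IsSymm)
    (hZ : Z.IsSymm) :
    christoffel g P U V Z = form (fderiv ℝ c.dchart P U V) (c.dchart P Z) := by
  rw [christoffel, h.metricDeriv_eq hP hU hV hZ, h.metricDeriv_eq hP hV hU hZ,
    h.metricDeriv_eq hP hZ hU hV, c.fderiv_dchart_comm hP V U, c.fderiv_dchart_comm hP Z U,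
    c.fderiv_dchart_comm hP Z V, h.form_comm (fderiv ℝ c.dchart P U Z)]
  ring

theorem isParallel_iff_hasDerivAt {γ : ℝ → SPD n} {u V : ℝ → Sym n} (hγ : IsVelocity γ u) :
    IsParallel g γ u V ↔ ∀ t, DifferentiableAt ℝ (fun s => (V s : Mat n)) t ∧
      HasDerivAt (fun s => c.dchart (γ s) (V s)) 0 t := by
  have hcov (t : ℝ) (V' Z : Sym n) : g (γ t) V' Z + christoffel g (γ t) (u t) (V t) Z =
      form (fderiv ℝ c.dchart (γ t) (u t) (V t) + c.dchart (γ t) V') (c.dchart (γ t) Z) := by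
    rw [h.metric_eq (γ t).2 V'.2 Z.2, h.christoffel_eq (γ t).2 (u t).2 (V t).2 Z.2, add_comm,
      map_add, _root_.add_apply]
  refine forall_congr' fun t => ⟨?_, ?_⟩
  · rintro ⟨V', hV', hZ⟩
    refine ⟨hV'.differentiableAt, ?_⟩
    have hd := c.hasDerivAt_dchart hγ hV'
    have hsymm := isSymm_of_hasDerivAt hd fun s => c.isSymm_dchart (posDef_isSymm (γ s).2) (V s).2
    convert hd using 1
    refine (h.eq_zero_of_form_self _ hsymm ?_).symm
    have := hZ ⟨_, c.isSymm_fderiv_param (c.isSymm_chart (γ t)) hsymm⟩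
    rwa [hcov, c.dchart_fderiv_param (γ t).2 hsymm] at this
  · rintro ⟨hV, hd⟩
    refine ⟨⟨_, isSymm_of_hasDerivAt hV.hasDerivAt fun s => (V s).2⟩, hV.hasDerivAt, fun Z => ?_⟩
    rw [hcov, (c.hasDerivAt_dchart hγ hV.hasDerivAt).unique hd, map_zero,
      _root_.zero_apply]

theorem isParallel_iff {γ : ℝ → SPD n} {u V : ℝ → Sym n} (hγ : IsVelocity γ u) :
    IsParallel g γ u V ↔ ∀ t, c.dchart (γ t) (V t) = c.dchart (γ 0) (V 0) := by
  rw [h.isParallel_iff_hasDerivAt hγ]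
  constructor
  · intro hV t
    exact is_const_of_deriv_eq_zero (fun t => (hV t).2.differentiableAt)
      (fun t => (hV t).2.deriv) t 0
  · intro hconst t
    refine ⟨?_, (hasDerivAt_const t (c.dchart (γ 0) (V 0))).congr_of_eventuallyEq
      (.of_forall hconst)⟩
    have hV (s) : (V s : Mat n) = fderiv ℝ c.param (c.chart (γ s)) (c.dchart (γ 0) (V 0)) := by
      rw [← hconst s, c.fderiv_param_dchart (γ s).2 (V s).2]
    rw [funext hV]
    exact (hasDerivAt_comp_clm_apply (c.hasFDerivAt_fderiv_param _) (c.hasDerivAt_chart hγ t)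
      (hasDerivAt_const t _)).differentiableAt

theorem chart_geodesic {γ : ℝ → SPD n} {u : ℝ → Sym n} (hγ : IsGeodesic g γ u) (t : ℝ) :
    c.chart (γ t) = c.chart (γ 0) + t • c.dchart (γ 0) (u 0) := by
  have hd (t) : HasDerivAt (fun s => c.chart (γ s) - s • c.dchart (γ 0) (u 0)) 0 t := by
    have := (c.hasDerivAt_chart hγ.1 t).sub
      ((hasDerivAt_id t).smul_const (c.dchart (γ 0) (u 0)))
    rwa [(h.isParallel_iff hγ.1).1 hγ.2 t, one_smul, sub_self] at this
  have := is_const_of_deriv_eq_zero (fun t => (hd t).differentiableAt) (fun t => (hd t).deriv) t 0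
  rwa [zero_smul, sub_zero, sub_eq_iff_eq_add] at this

theorem exists_isGeodesic (P : SPD n) {w : Mat n} (hw : w.IsSymm) :
    ∃ γ u, IsGeodesic g γ u ∧ γ 0 = P ∧ ∀ t, c.dchart (γ t) (u t) = w := by
  have hX := isSymm_add_smul (c.isSymm_chart P) hw
  let γ (t : ℝ) : SPD n := ⟨c.param (c.chart P + t • w), c.posDef_param _ (hX t)⟩
  let u (t : ℝ) : Sym n := ⟨fderiv ℝ c.param (c.chart (γ t)) w,
    c.isSymm_fderiv_param (c.isSymm_chart _) hw⟩
  have hu (t) : c.dchart (γ t) (u t) = w := c.dchart_fderiv_param (γ t).2 hw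
  have hγ : IsVelocity γ u := fun t => by
    rw [show (u t : Mat n) = fderiv ℝ c.param (c.chart P + t • w) w by
      simp only [u, γ, c.chart_param _ (hX t)]]
    exact HasFDerivAt.comp_hasDerivAt (f := fun s : ℝ => c.chart P + s • w) t
      (c.hasFDerivAt_param _) (hasDerivAt_add_smul _ w t)
  refine ⟨γ, u, ⟨hγ, (h.isParallel_iff hγ).2 fun t => by rw [hu, hu]⟩, Subtype.ext ?_, hu⟩
  simp only [γ, zero_smul, add_zero, c.param_chart P P.2]

theorem chart_Exp (P : SPD n) (W : Sym n) :
    c.chart (Exp g P W) = c.chart P + c.dchart P W := by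
  have hP := posDef_isSymm P.2
  obtain ⟨γ₀, u₀, hγ₀, h₀, hu₀⟩ := h.exists_isGeodesic P (c.isSymm_dchart hP W.2)
  obtain ⟨γ, u, hγ, h0, hu0, h1⟩ := exists_isGeodesic_Exp (g := g) (P := P) (W := W)
    ⟨γ₀, u₀, hγ₀, h₀, c.dchart_injective P (by simpa only [h₀] using hu₀ 0)⟩
  rw [← h1, h.chart_geodesic hγ 1, h0, hu0, one_smul]

theorem dchart_Log (P Q : SPD n) : c.dchart P (Log g P Q) = c.chart Q - c.chart P := by
  have hsymm : (c.chart Q - c.chart P).IsSymm := (c.isSymm_chart Q).sub (c.isSymm_chart P)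
  have hExp : Exp g P (Log g P Q) = Q := Exp_Log
    ⟨⟨_, c.isSymm_fderiv_param (c.isSymm_chart P) hsymm⟩, c.chart_injective (by
      simp only [h.chart_Exp, c.dchart_fderiv_param P.2 hsymm, add_sub_cancel])⟩
  conv_rhs => rw [← hExp, h.chart_Exp, add_sub_cancel_left]

theorem dchart_transport (P Q : SPD n) (W : Sym n) :
    c.dchart Q (transport g P Q W) = c.dchart P W := by
  have hW := c.isSymm_dchart (posDef_isSymm P.2) W.2
  obtain ⟨γ₀, u₀, hγ₀, h₀, hu₀⟩ := h.exists_isGeodesic P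
    ((c.isSymm_chart Q).sub (c.isSymm_chart P))
  have h₁ : γ₀ 1 = Q := c.chart_injective (by
    simp only
    rw [h.chart_geodesic hγ₀ 1, hu₀, h₀, one_smul, add_sub_cancel])
  let V₀ (t : ℝ) : Sym n := ⟨fderiv ℝ c.param (c.chart (γ₀ t)) (c.dchart P W),
    c.isSymm_fderiv_param (c.isSymm_chart _) hW⟩
  have hV₀ (t) : c.dchart (γ₀ t) (V₀ t) = c.dchart P W := c.dchart_fderiv_param (γ₀ t).2 hW
  obtain ⟨γ, u, V, hγ, h0, h1, hV, hV0, hV1⟩ := exists_isParallel_transport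
    (g := g) (P := P) (Q := Q) (W := W) ⟨γ₀, u₀, V₀, hγ₀, h₀, h₁,
      (h.isParallel_iff hγ₀.1).2 fun t => by rw [hV₀, hV₀],
      c.dchart_injective P (by simpa only [h₀] using hV₀ 0)⟩
  have := (h.isParallel_iff hγ.1).1 hV 1
  rwa [h1, h0, hV0, hV1] at this

end Metric

section Gyro

variable {c : GlobalChart n} {g : Geometry} {form : Mat n →L[ℝ] Mat n →L[ℝ] ℝ}
  (h : c.IsFlat (metric g) form)

include h

theorem chart_oplus (P Q : SPD n) : c.chart (oplus g P Q) = c.chart P + c.chart Q := by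
  have h1 : c.chart (one n) = 0 := c.chart_one
  rw [oplus, h.chart_Exp, h.dchart_transport, h.dchart_Log, h1, sub_zero]

theorem chart_ominus (P : SPD n) : c.chart (ominus g P) = -c.chart P := by
  have h1 : c.chart (one n) = 0 := c.chart_one
  have hsymm := (c.isSymm_chart P).neg
  have hinv : oplus g (ominus g P) P = one n := ominus_oplus
    ⟨⟨_, c.posDef_param _ hsymm⟩, c.chart_injective (by
      simp only [h.chart_oplus, c.chart_param _ hsymm, h1, neg_add_cancel])⟩
  exact eq_neg_of_add_eq_zero_left (by rw [← h.chart_oplus, hinv, h1])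

theorem gyr_eq (P Q R : SPD n) : gyr g P Q R = R := c.chart_injective (by
  simp only [gyr, h.chart_oplus, h.chart_ominus]
  abel)

theorem isGyroisometry_gyr (P Q : SPD n) : IsGyroisometry g (gyr g P Q) := fun R S => by
  rw [h.gyr_eq, h.gyr_eq]

end Gyro

end GlobalChart.IsFlat

/-! ### The differential of the exponential -/

section Exponential

variable {A : Type*} [NormedRing A] [NormedAlgebra ℝ A] [CompleteSpace A] {X Y : A}

theorem contDiff_exp : ContDiff ℝ 2 (exp : A → A) :=
  contDiff_iff_contDiffAt.2 fun X => (exp_analytic (𝕂 := ℝ) X).contDiffAt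

theorem hasDerivAt_exp_add_smul (X Y : A) :
    HasDerivAt (fun t : ℝ => exp (X + t • Y)) (fderiv ℝ exp X Y) 0 :=
  (contDiff_exp.differentiable two_ne_zero X).hasFDerivAt.hasLineDerivAt Y

theorem commute_exp_of_fderiv_exp_eq_zero (h : fderiv ℝ exp X Y = 0) : Commute Y (exp X) := by
  have hline := hasDerivAt_add_smul X Y 0
  have hexp := hasDerivAt_exp_add_smul X Y
  have hcomm : (fun t : ℝ => X + t • Y) * (fun t : ℝ => exp (X + t • Y)) =
      (fun t : ℝ => exp (X + t • Y)) * fun t : ℝ => X + t • Y :=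
    funext fun t => ((Commute.refl (X + t • Y)).exp_right).eq
  have hmul := hline.mul hexp
  rw [hcomm] at hmul
  rw [commute_iff_eq]
  simpa [h] using hmul.unique (hexp.mul hline)

theorem fderiv_exp_of_commute (h : Commute X Y) : fderiv ℝ exp X Y = exp X * Y := by
  let +nondep : NormedAlgebra ℚ A := .restrictScalars ℚ ℝ A
  have hprod : (fun t : ℝ => exp (X + t • Y)) = fun t : ℝ => exp X * exp (t • Y) :=
    funext fun t => exp_add_of_commute (h.smul_right t)
  have hexp := hasDerivAt_exp_add_smul X Y
  rw [hprod] at hexp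
  simpa using hexp.unique ((hasDerivAt_exp_smul_const Y (0 : ℝ)).const_mul (exp X))

theorem eq_zero_of_fderiv_exp_eq_zero (hXY : Commute (exp X) Y → Commute X Y)
    (h : fderiv ℝ exp X Y = 0) : Y = 0 := by
  let +nondep : NormedAlgebra ℚ A := .restrictScalars ℚ ℝ A
  rw [fderiv_exp_of_commute (hXY (commute_exp_of_fderiv_exp_eq_zero h).symm)] at h
  exact (isUnit_exp X).mul_right_eq_zero.1 h

end Exponential

theorem posDef_exp {X : Mat n} (hX : X.IsSymm) : (exp X).PosDef :=
  isStrictlyPositive_iff_posDef.1 ((isUnit_exp X).isStrictlyPositive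
    (IsSelfAdjoint.exp_nonneg (isHermitian_iff_isSymm.2 hX)))

/-! ### The Log-Euclidean geometry -/

theorem logm_exp {X : Mat n} (hX : X.IsSymm) : logm (exp X) = X :=
  CFC.log_exp X (isHermitian_iff_isSymm.2 hX)

theorem exp_logm {P : Mat n} (hP : P.PosDef) : exp (logm P) = P :=
  CFC.exp_log P hP.isStrictlyPositive

theorem isSymm_logm (P : Mat n) : (logm P).IsSymm :=
  isHermitian_iff_isSymm.1 (cfc_predicate Real.log P)

/-- The matrix logarithm as a chart of the SPD matrices. -/
def logChart (n : ℕ) : GlobalChart n where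
  chart := logm
  param := exp
  isSymm_chart := isSymm_logm
  posDef_param _ := posDef_exp
  chart_param _ := logm_exp
  param_chart _ := exp_logm
  chart_one := CFC.log_one
  contDiff_param := contDiff_exp
  eq_zero_of_fderiv_param X V hX _ := eq_zero_of_fderiv_exp_eq_zero fun h => by
    have hlog : Commute (logm (exp X)) V := h.cfc_real Real.log
    rwa [logm_exp hX] at hlog

theorem Dlogm_fderiv_param {X V : Mat n} (hX : X.IsSymm) (hV : V.IsSymm) :
    Dlogm ((logChart n).param X) (fderiv ℝ (logChart n).param X V) = V :=
  ((logChart n).hasDerivAt_chart_add_smul (posDef_exp hX)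
    ((logChart n).isSymm_fderiv_param hX hV)).deriv.trans
      ((logChart n).dchart_param_fderiv_param hX hV)

theorem frob_comm (A B : Mat n) : frob A B = frob B A := by
  rw [frob, frob, ← trace_transpose, transpose_mul, transpose_transpose]

theorem eq_zero_of_frob_self {A : Mat n} (h : frob A A = 0) : A = 0 := by
  rw [frob, ← conjTranspose_eq_transpose_of_trivial] at h
  exact trace_conjTranspose_mul_self_eq_zero_iff.1 h

/-- The Frobenius inner product as a continuous bilinear form. -/
def frobForm (n : ℕ) : Mat n →L[ℝ] Mat n →L[ℝ] ℝ :=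
  (LinearMap.mk₂ ℝ frob (by simp [frob, add_mul]) (by simp [frob]) (by simp [frob, mul_add])
    (by simp [frob])).toContinuousBilinearMap

theorem isFlat_logChart (n : ℕ) : (logChart n).IsFlat metricLE (frobForm n) where
  form_comm := frob_comm
  eq_zero_of_form_self _ _ := eq_zero_of_frob_self
  metric_param X V W hX hV hW := by
    rw [metricLE, Dlogm_fderiv_param hX hV, Dlogm_fderiv_param hX hW]
    rfl

/-! ### The Cholesky factorization -/

theorem isLowerTriangular_iff {A : Mat n} : A.IsLowerTriangular ↔ ∀ i j, i < j → A i j = 0 :=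
  Iff.rfl

theorem isLowerTriangular_inv {A : Mat n} (h : A.IsLowerTriangular) (hA : IsUnit A) :
    A⁻¹.IsLowerTriangular := by
  have := hA.invertible
  exact blockTriangular_inv_of_blockTriangular h

theorem isUnit_iff_of_isLowerTriangular {A : Mat n} (h : A.IsLowerTriangular) :
    IsUnit A ↔ ∀ i, A i i ≠ 0 := by
  rw [isUnit_iff_isUnit_det, det_of_isLowerTriangular A h, isUnit_iff_ne_zero,
    Finset.prod_ne_zero_iff]
  simp only [Finset.mem_univ, true_imp_iff]

theorem mul_apply_self_of_isLowerTriangular {A B : Mat n} (hA : A.IsLowerTriangular)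
    (hB : B.IsLowerTriangular) (i : Fin n) : (A * B) i i = A i i * B i i := by
  rw [mul_apply, Finset.sum_eq_single i _ (by simp)]
  intro j _ hj
  rcases hj.lt_or_gt with h | h
  · rw [isLowerTriangular_iff.1 hB j i h, mul_zero]
  · rw [isLowerTriangular_iff.1 hA i j h, zero_mul]

theorem eq_one_of_isLowerTriangular_of_mul_transpose {A : Mat n} (hA : A.IsLowerTriangular)
    (hpos : ∀ i, 0 < A i i) (h : A * Aᵀ = 1) : A = 1 := by
  have hAt : Aᵀ.IsLowerTriangular := by
    rw [← inv_eq_right_inv h]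
    exact isLowerTriangular_inv hA (.of_mul_eq_one _ h)
  ext i j
  rcases lt_trichotomy i j with hij | rfl | hij
  · rw [isLowerTriangular_iff.1 hA i j hij, one_apply_ne hij.ne]
  · have hsq := congrFun₂ h i i
    rw [mul_apply_self_of_isLowerTriangular hA hAt, transpose_apply, one_apply_eq] at hsq
    rw [one_apply_eq]
    exact (pow_eq_one_iff_of_nonneg (hpos i).le two_ne_zero).1 (by rw [sq, hsq])
  · rw [one_apply_ne hij.ne', ← transpose_apply A, isLowerTriangular_iff.1 hAt j i hij]

section IsCholesky

variable {L P : Mat n}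

theorem isLowerTriangular_of_isCholesky (h : IsCholesky L P) : L.IsLowerTriangular :=
  isLowerTriangular_iff.2 h.1

theorem isUnit_of_isCholesky (h : IsCholesky L P) : IsUnit L :=
  (isUnit_iff_of_isLowerTriangular (isLowerTriangular_of_isCholesky h)).2 fun i => (h.2.1 i).ne'

theorem isCholesky_unique {K : Mat n} (hL : IsCholesky L P) (hK : IsCholesky K P) : L = K := by
  have hK' := isLowerTriangular_of_isCholesky hK
  have hL' := isLowerTriangular_of_isCholesky hL
  have hdet : IsUnit K.det := (isUnit_iff_isUnit_det K).1 (isUnit_of_isCholesky hK)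
  have hlower : (K⁻¹ * L).IsLowerTriangular :=
    (isLowerTriangular_inv hK' (isUnit_of_isCholesky hK)).mul hL'
  have hmul : K * (K⁻¹ * L) = L := mul_nonsing_inv_cancel_left _ _ hdet
  have hpos (i) : 0 < (K⁻¹ * L) i i := by
    have := hL.2.1 i
    rw [← hmul, mul_apply_self_of_isLowerTriangular hK' hlower] at this
    exact (pos_iff_pos_of_mul_pos this).1 (hK.2.1 i)
  have hone : K⁻¹ * L = 1 := eq_one_of_isLowerTriangular_of_mul_transpose hlower hpos (by
    rw [transpose_mul, transpose_nonsing_inv, Matrix.mul_assoc, ← Matrix.mul_assoc L,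
      ← hL.2.2, hK.2.2, Matrix.mul_assoc K, mul_nonsing_inv _ (by rwa [det_transpose]),
      Matrix.mul_one, nonsing_inv_mul _ hdet])
  rw [← hmul, hone, Matrix.mul_one]

theorem exists_isLowerTriangular_mul_transpose (hP : P.PosDef) :
    ∃ A : Mat n, A.IsLowerTriangular ∧ P = A * Aᵀ := by
  have hinv : IsUnit (LDL.lowerInv hP) := isUnit_of_invertible _
  have hdiag : ∀ i, 0 < LDL.diagEntries hP i := by
    rw [← posDef_diagonal_iff, ← LDL.diag, LDL.diag_eq_lowerInv_conj hP]
    exact hP.mul_mul_conjTranspose_same (vecMul_injective_iff_isUnit.2 hinv)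
  have hlower : (LDL.lower hP).IsLowerTriangular :=
    isLowerTriangular_inv (isLowerTriangular_iff.2 fun i j hij => LDL.lowerInv_triangular hP hij)
      hinv
  refine ⟨LDL.lower hP * diagonal fun i => √(LDL.diagEntries hP i),
    hlower.mul (blockTriangular_diagonal _), ?_⟩
  rw [transpose_mul, diagonal_transpose, Matrix.mul_assoc, ← Matrix.mul_assoc (diagonal _),
    diagonal_mul_diagonal, funext fun i => Real.mul_self_sqrt (hdiag i).le, ← Matrix.mul_assoc]
  exact (LDL.lower_conj_diag hP).symm

theorem exists_isCholesky (hP : P.PosDef) : ∃ L, IsCholesky L P := by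
  obtain ⟨A, hA, rfl⟩ := exists_isLowerTriangular_mul_transpose hP
  have hne := (isUnit_iff_of_isLowerTriangular hA).1 (isUnit_of_mul_isUnit_left hP.isUnit)
  -- Make the diagonal positive by changing signs of columns.
  let σ (i : Fin n) : ℝ := SignType.sign (A i i)
  have hσ (i) : σ i * σ i = 1 := by
    rcases (hne i).lt_or_gt with h | h <;> simp [σ, h]
  refine ⟨A * diagonal σ, hA.mul (blockTriangular_diagonal _), fun i => ?_, ?_⟩
  · rw [mul_diagonal, self_mul_sign]
    exact abs_pos.2 (hne i)
  · rw [transpose_mul, diagonal_transpose, Matrix.mul_assoc, ← Matrix.mul_assoc (diagonal _),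
      diagonal_mul_diagonal, funext hσ, diagonal_one, Matrix.one_mul]

theorem isCholesky_cholesky (hP : P.PosDef) : IsCholesky (cholesky P) P :=
  Classical.epsilon_spec (exists_isCholesky hP)

theorem cholesky_eq (h : IsCholesky L P) : cholesky P = L :=
  isCholesky_unique (Classical.epsilon_spec (p := fun K => IsCholesky K P) ⟨L, h⟩) h

theorem posDef_of_isCholesky (h : IsCholesky L P) : P.PosDef := by
  rw [h.2.2, ← conjTranspose_eq_transpose_of_trivial]
  exact .mul_conjTranspose_self _ (vecMul_injective_iff_isUnit.2 (isUnit_of_isCholesky h))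

theorem lowerHalf_add_transpose {A : Mat n} (hA : A.IsLowerTriangular) :
    lowerHalf (A + Aᵀ) = A := by
  have hA' := isLowerTriangular_iff.1 hA
  ext i j
  rcases lt_trichotomy i j with hij | rfl | hij
  · simp [lowerHalf, hij.not_gt, hij.ne, hA' i j hij]
  · simp [lowerHalf]
  · simp [lowerHalf, hij, hA' j i hij]

theorem Dcholesky_mul_transpose_add {A : Mat n} (h : IsCholesky L P) (hA : A.IsLowerTriangular) :
    Dcholesky P (A * Lᵀ + L * Aᵀ) = A := by
  have hL := isUnit_of_isCholesky h
  have hdet := (isUnit_iff_isUnit_det L).1 hL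
  have hconj : L⁻¹ * (A * Lᵀ + L * Aᵀ) * (L⁻¹)ᵀ = L⁻¹ * A + (L⁻¹ * A)ᵀ := by
    rw [transpose_mul, transpose_nonsing_inv, Matrix.mul_add, Matrix.add_mul,
      nonsing_inv_mul_cancel_left _ _ hdet, ← Matrix.mul_assoc,
      mul_nonsing_inv_cancel_right _ _ (by rwa [det_transpose])]
  rw [Dcholesky, cholesky_eq h, hconj, lowerHalf_add_transpose
    ((isLowerTriangular_inv (isLowerTriangular_of_isCholesky h) hL).mul hA),
    mul_nonsing_inv_cancel_left _ _ hdet]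

end IsCholesky

/-! ### The Log-Cholesky geometry -/

theorem contDiff_matrix {E : Type*} [NormedAddCommGroup E] [NormedSpace ℝ E] {k : WithTop ℕ∞}
    {f : E → Mat n} (hf : ∀ i j, ContDiff ℝ k fun x => f x i j) : ContDiff ℝ k f :=
  ((ofLinearEquiv ℝ : (Fin n → Fin n → ℝ) ≃ₗ[ℝ] Mat n).toContinuousLinearEquiv.contDiff).comp
    (contDiff_pi.2 fun i => contDiff_pi.2 fun j => hf i j)

theorem contDiff_apply_apply (i j : Fin n) {k : WithTop ℕ∞} :
    ContDiff ℝ k fun X : Mat n => X i j :=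
  (entryLinearMap ℝ ℝ i j).toContinuousLinearMap.contDiff

/-- The Cholesky factor with given entries below the diagonal and given logarithms of its diagonal
entries. -/
def cholFactor (X : Mat n) : Mat n :=
  of fun i j => if j < i then X i j else if i = j then Real.exp (X i i) else 0

/-- The differential of `cholFactor`. -/
def dcholFactor (X V : Mat n) : Mat n :=
  of fun i j => if j < i then V i j else if i = j then Real.exp (X i i) * V i i else 0

/-- The SPD matrix with given Log-Cholesky coordinates. -/
def cholParam (X : Mat n) : Mat n := cholFactor X * (cholFactor X)ᵀ

/-- The Log-Cholesky coordinates: the symmetric matrix made of the entries of the Cholesky factor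
below the diagonal and the logarithms of its diagonal entries. -/
def logCholesky (P : Mat n) : Mat n :=
  of fun i j => if i = j then Real.log (cholesky P i i) else cholesky P i j + cholesky P j i

theorem isCholesky_cholFactor (X : Mat n) : IsCholesky (cholFactor X) (cholParam X) :=
  ⟨fun i j hij => by simp [cholFactor, hij.not_gt, hij.ne],
    fun i => by simp [cholFactor, Real.exp_pos], rfl⟩

theorem isLowerTriangular_dcholFactor (X V : Mat n) : (dcholFactor X V).IsLowerTriangular :=
  isLowerTriangular_iff.2 fun i j hij => by simp [dcholFactor, hij.not_gt, hij.ne]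

theorem contDiff_cholFactor {k : WithTop ℕ∞} : ContDiff ℝ k (cholFactor (n := n)) := by
  refine contDiff_matrix fun i j => ?_
  simp only [cholFactor, of_apply]
  split_ifs
  exacts [contDiff_apply_apply i j, (contDiff_apply_apply i i).exp, contDiff_const]

theorem hasDerivAt_cholFactor (X V : Mat n) :
    HasDerivAt (fun t : ℝ => cholFactor (X + t • V)) (dcholFactor X V) 0 := by
  refine hasDerivAt_pi.2 fun i => hasDerivAt_pi.2 fun j => ?_
  have hentry (j) : HasDerivAt (fun t : ℝ => (X + t • V) i j) (V i j) 0 :=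
    hasDerivAt_add_smul (X i j) (V i j) 0
  simp only [cholFactor, dcholFactor, of_apply]
  split_ifs
  · exact hentry j
  · simpa using (hentry i).exp
  · exact hasDerivAt_const _ _

theorem contDiff_cholParam {k : WithTop ℕ∞} :
    ContDiff ℝ k (cholParam (n := n)) :=
  contDiff_cholFactor.mul ((starL' ℝ : Mat n ≃L[ℝ] Mat n).contDiff.comp contDiff_cholFactor)

theorem fderiv_cholParam (X V : Mat n) :
    fderiv ℝ cholParam X V =
      dcholFactor X V * (cholFactor X)ᵀ + cholFactor X * (dcholFactor X V)ᵀ := by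
  have hfactor := hasDerivAt_cholFactor X V
  have h := hfactor.mul (hasDerivAt_transpose hfactor)
  simp only [zero_smul, add_zero] at h
  exact HasDerivAt.unique ((contDiff_cholParam.differentiable one_ne_zero
    X).hasFDerivAt.hasLineDerivAt V) h

theorem eq_zero_of_dcholFactor_eq_zero {X V : Mat n} (hV : V.IsSymm) (h : dcholFactor X V = 0) :
    V = 0 := by
  have hlower {i j} (hij : j < i) : V i j = 0 := by simpa [dcholFactor, hij] using congrFun₂ h i j
  ext i j
  rcases lt_trichotomy i j with hij | rfl | hij
  · rw [← hV.apply, hlower hij, Matrix.zero_apply]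
  · simpa [dcholFactor, Real.exp_ne_zero] using congrFun₂ h i i
  · exact hlower hij

theorem Dcholesky_fderiv_cholParam (X V : Mat n) :
    Dcholesky (cholParam X) (fderiv ℝ cholParam X V) = dcholFactor X V := by
  rw [fderiv_cholParam, Dcholesky_mul_transpose_add (isCholesky_cholFactor X)
    (isLowerTriangular_dcholFactor X V)]

theorem Dcholesky_zero (P : Mat n) : Dcholesky P 0 = 0 := by
  have hzero : lowerHalf (0 : Mat n) = 0 := by
    ext i j
    simp [lowerHalf]
  rw [Dcholesky, Matrix.mul_zero, Matrix.zero_mul, hzero, Matrix.mul_zero]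

theorem isSymm_logCholesky (P : Mat n) : (logCholesky P).IsSymm := by
  ext i j
  obtain rfl | hij := eq_or_ne i j
  · rfl
  · simp [logCholesky, hij, hij.symm, add_comm]

theorem logCholesky_cholParam {X : Mat n} (hX : X.IsSymm) :
    logCholesky (cholParam X) = X := by
  ext i j
  rw [logCholesky, cholesky_eq (isCholesky_cholFactor X)]
  rcases lt_trichotomy i j with hij | rfl | hij
  · simp [cholFactor, hij, hij.ne, hij.not_gt, hX.apply i j]
  · simp [cholFactor]
  · simp [cholFactor, hij, hij.ne, hij.ne', hij.not_gt]

theorem cholFactor_logCholesky {P : Mat n} (hP : P.PosDef) :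
    cholFactor (logCholesky P) = cholesky P := by
  obtain ⟨hlower, hpos, -⟩ := isCholesky_cholesky hP
  ext i j
  rcases lt_trichotomy i j with hij | rfl | hij
  · simp [cholFactor, hij.ne, hij.not_gt, hlower i j hij]
  · simp [cholFactor, logCholesky, Real.exp_log (hpos i)]
  · simp [cholFactor, logCholesky, hij, hij.ne', hlower j i hij]

theorem logCholesky_one : logCholesky (1 : Mat n) = 0 := by
  have hone : IsCholesky (1 : Mat n) 1 :=
    ⟨fun i j hij => one_apply_ne hij.ne, fun i => by simp, by simp⟩
  ext i j
  rw [logCholesky, cholesky_eq hone]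
  obtain rfl | hij := eq_or_ne i j
  · simp
  · simp [hij, hij.symm]

/-- The Log-Cholesky coordinates as a chart of the SPD matrices. -/
def logCholeskyChart (n : ℕ) : GlobalChart n where
  chart := logCholesky
  param := cholParam
  isSymm_chart := isSymm_logCholesky
  posDef_param X _ := posDef_of_isCholesky (isCholesky_cholFactor X)
  chart_param _ := logCholesky_cholParam
  param_chart P hP := by rw [cholParam, cholFactor_logCholesky hP, ← (isCholesky_cholesky hP).2.2]
  chart_one := logCholesky_one
  contDiff_param := contDiff_cholParam
  eq_zero_of_fderiv_param X V _ hV h := eq_zero_of_dcholFactor_eq_zero (X := X) hV (by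
    rw [← Dcholesky_fderiv_cholParam, h, Dcholesky_zero])

theorem metricLower_comm (L X Y : Mat n) : metricLower L X Y = metricLower L Y X := by
  simp only [metricLower, mul_comm]

theorem eq_zero_of_metricLower_one_self {X : Mat n} (hX : X.IsSymm) (h : metricLower 1 X X = 0) :
    X = 0 := by
  have hoff (i j) : 0 ≤ if j < i then X i j * X i j else 0 :=
    ite_nonneg (mul_self_nonneg _) le_rfl
  have hdiag (i) : 0 ≤ X i i * X i i / (1 : Mat n) i i ^ 2 :=
    div_nonneg (mul_self_nonneg _) (sq_nonneg _)
  obtain ⟨hoff_zero, hdiag_zero⟩ := (add_eq_zero_iff_of_nonneg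
    (Finset.sum_nonneg fun i _ => Finset.sum_nonneg fun j _ => hoff i j)
    (Finset.sum_nonneg fun i _ => hdiag i)).1 h
  have hlower {i j} (hij : j < i) : X i j = 0 := by
    have hrow := (Fintype.sum_eq_zero_iff_of_nonneg fun i =>
      Finset.sum_nonneg fun j _ => hoff i j).1 hoff_zero
    have := congrFun ((Fintype.sum_eq_zero_iff_of_nonneg (hoff i)).1 (congrFun hrow i)) j
    simpa [hij] using this
  ext i j
  rcases lt_trichotomy i j with hij | rfl | hij
  · rw [← hX.apply, hlower hij, Matrix.zero_apply]
  · simpa using congrFun ((Fintype.sum_eq_zero_iff_of_nonneg hdiag).1 hdiag_zero) i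
  · exact hlower hij

theorem metricLower_dcholFactor (X V W : Mat n) :
    metricLower (cholFactor X) (dcholFactor X V) (dcholFactor X W) = metricLower 1 V W := by
  unfold metricLower
  congr 1
  · refine Finset.sum_congr rfl fun i _ => Finset.sum_congr rfl fun j _ => ?_
    split_ifs with hij <;> simp [dcholFactor, hij]
  · refine Finset.sum_congr rfl fun i _ => ?_
    have := Real.exp_ne_zero (X i i)
    simp only [cholFactor, dcholFactor, of_apply, lt_irrefl, if_false, if_true, one_apply_eq]
    field_simp

theorem metricLower_add_left (L X Y Z : Mat n) :
    metricLower L (X + Y) Z = metricLower L X Z + metricLower L Y Z := by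
  simp only [metricLower, Matrix.add_apply, add_mul, add_div, ite_add_zero, Finset.sum_add_distrib]
  ring

theorem metricLower_smul_left (L : Mat n) (c : ℝ) (X Y : Mat n) :
    metricLower L (c • X) Y = c * metricLower L X Y := by
  simp only [metricLower, Matrix.smul_apply, smul_eq_mul, mul_assoc, mul_div_assoc, mul_add,
    Finset.mul_sum, mul_ite, mul_zero]

/-- The Log-Cholesky metric at the identity as a continuous bilinear form. -/
def lowerForm (n : ℕ) : Mat n →L[ℝ] Mat n →L[ℝ] ℝ :=
  (LinearMap.mk₂ ℝ (metricLower 1) (metricLower_add_left 1) (metricLower_smul_left 1)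
    (fun X Y Z => by simp only [metricLower_comm 1 X, metricLower_add_left])
    (fun c X Y => by simp only [metricLower_comm 1 X, metricLower_smul_left,
      smul_eq_mul])).toContinuousBilinearMap

theorem metricLC_cholParam (X V W : Mat n) :
    metricLC (cholParam X) (fderiv ℝ cholParam X V) (fderiv ℝ cholParam X W) =
      metricLower 1 V W := by
  rw [metricLC, Dcholesky_fderiv_cholParam, Dcholesky_fderiv_cholParam,
    cholesky_eq (isCholesky_cholFactor X), metricLower_dcholFactor]

theorem isFlat_logCholeskyChart (n : ℕ) :
    (logCholeskyChart n).IsFlat metricLC (lowerForm n) where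
  form_comm := metricLower_comm 1
  eq_zero_of_form_self _ := eq_zero_of_metricLower_one_self
  metric_param X V W _ _ _ := metricLC_cholParam X V W

/-! ### The Levi-Civita connection of the Affine-Invariant metric -/

theorem hasDerivAt_matrix_inv {f : ℝ → Mat n} {f' : Mat n} {t : ℝ} (hf : HasDerivAt f f' t)
    (h : IsUnit (f t)) : HasDerivAt (fun s => (f s)⁻¹) (-((f t)⁻¹ * f' * (f t)⁻¹)) t := by
  obtain ⟨x, hx⟩ := h
  have hinv := hasFDerivAt_ringInverse (𝕜 := ℝ) x
  rw [hx] at hinv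
  have hcomp : HasDerivAt (fun s => Ring.inverse (f s)) (-(↑x⁻¹ * f' * ↑x⁻¹)) t :=
    hinv.comp_hasDerivAt t hf
  simp only [nonsing_inv_eq_ringInverse]
  rwa [← Ring.inverse_unit, hx] at hcomp

theorem isUnit_det_of_posDef {P : Mat n} (hP : P.PosDef) : IsUnit P.det :=
  (isUnit_iff_isUnit_det P).1 hP.isUnit

theorem isSymm_inv {A : Mat n} (hA : A.IsSymm) : A⁻¹.IsSymm := by
  rw [IsSymm, transpose_nonsing_inv, hA.eq]

theorem isSymm_mul_mul_transpose {X : Mat n} (hX : X.IsSymm) (B : Mat n) :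
    (B * X * Bᵀ).IsSymm := by
  rw [IsSymm, transpose_mul, transpose_mul, transpose_transpose, hX.eq, Matrix.mul_assoc]

theorem posDef_mul_mul_transpose {P B : Mat n} (hP : P.PosDef) (hB : IsUnit B) :
    (B * P * Bᵀ).PosDef := by
  rw [← conjTranspose_eq_transpose_of_trivial]
  exact hP.mul_mul_conjTranspose_same (vecMul_injective_iff_isUnit.2 hB)

theorem metricDeriv_metricAI {P : Mat n} (hP : P.PosDef) (U V W : Mat n) :
    metricDeriv metricAI P U V W =
      -(P⁻¹ * U * P⁻¹ * V * P⁻¹ * W).trace - (P⁻¹ * V * P⁻¹ * U * P⁻¹ * W).trace := by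
  have hinv := hasDerivAt_matrix_inv (hasDerivAt_add_smul P U 0) (by simpa using hP.isUnit)
  have hmul := ((hinv.mul_const V).mul hinv).mul_const W
  have htrace := (traceLinearMap (Fin n) ℝ ℝ).toContinuousLinearMap.hasFDerivAt.comp_hasDerivAt 0
    hmul
  refine htrace.deriv.trans ?_
  simp [Matrix.mul_assoc, Matrix.add_mul, trace_add, sub_eq_add_neg]

theorem metricAI_add_christoffel {P : Mat n} (hP : P.PosDef) (U V V' Z : Mat n) :
    metricAI P V' Z + christoffel metricAI P U V Z =
      (P⁻¹ * (V' - (1 / 2 : ℝ) • (U * P⁻¹ * V + V * P⁻¹ * U)) * P⁻¹ * Z).trace := by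
  have hcycle (A B : Mat n) :
      (P⁻¹ * Z * P⁻¹ * A * P⁻¹ * B).trace = (P⁻¹ * A * P⁻¹ * B * P⁻¹ * Z).trace := by
    rw [Matrix.mul_assoc _ _ B, Matrix.mul_assoc _ A, Matrix.mul_assoc _ P⁻¹,
      trace_mul_comm (P⁻¹ * Z)]
    simp only [Matrix.mul_assoc]
  have hcycle' (A B : Mat n) :
      (P⁻¹ * A * P⁻¹ * Z * P⁻¹ * B).trace = (P⁻¹ * B * P⁻¹ * A * P⁻¹ * Z).trace := by
    rw [Matrix.mul_assoc, trace_mul_comm]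
    simp only [Matrix.mul_assoc]
  rw [christoffel, metricDeriv_metricAI hP, metricDeriv_metricAI hP, metricDeriv_metricAI hP,
    metricAI, hcycle, hcycle']
  simp only [Matrix.mul_sub, Matrix.sub_mul, Matrix.mul_smul, Matrix.smul_mul, Matrix.mul_add,
    Matrix.add_mul, trace_sub, trace_smul, trace_add, smul_eq_mul, Matrix.mul_assoc]
  ring

theorem eq_zero_of_forall_trace_inv_mul_eq_zero {P X : Mat n} (hP : P.PosDef) (hX : X.IsSymm)
    (h : ∀ Z : Mat n, Z.IsSymm → (P⁻¹ * X * P⁻¹ * Z).trace = 0) : X = 0 := by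
  have hdet := isUnit_det_of_posDef hP
  have hsymm : (P * X * P).IsSymm := by
    simpa only [(posDef_isSymm hP).eq] using isSymm_mul_mul_transpose hX P
  have htrace := h _ hsymm
  rw [show P⁻¹ * X * P⁻¹ * (P * X * P) = P⁻¹ * (X * X * P) by
      simp only [Matrix.mul_assoc, nonsing_inv_mul_cancel_left _ _ hdet],
    trace_mul_comm, mul_nonsing_inv_cancel_right _ _ hdet] at htrace
  exact eq_zero_of_frob_self (by rw [frob, hX.eq, htrace])

/-- The generator `B` of the Affine-Invariant geodesic `t ↦ exp (tB) P exp (tB)ᵀ` through `P` with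
velocity `W`. -/
def geodesicGenerator (P : SPD n) (W : Sym n) : Mat n := (1 / 2 : ℝ) • ((W : Mat n) * (P : Mat n)⁻¹)

theorem transpose_geodesicGenerator (P : SPD n) (W : Sym n) :
    (geodesicGenerator P W)ᵀ = (1 / 2 : ℝ) • ((P : Mat n)⁻¹ * (W : Mat n)) := by
  rw [geodesicGenerator, transpose_smul, transpose_mul, (isSymm_inv (posDef_isSymm P.2)).eq,
    W.2.eq]

theorem geodesicGenerator_mul (P : SPD n) (W : Sym n) :
    geodesicGenerator P W * P = (1 / 2 : ℝ) • (W : Mat n) := by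
  rw [geodesicGenerator, Matrix.smul_mul,
    nonsing_inv_mul_cancel_right _ _ (isUnit_det_of_posDef P.2)]

theorem mul_transpose_geodesicGenerator (P : SPD n) (W : Sym n) :
    P * (geodesicGenerator P W)ᵀ = (1 / 2 : ℝ) • (W : Mat n) := by
  rw [transpose_geodesicGenerator, Matrix.mul_smul,
    mul_nonsing_inv_cancel_left _ _ (isUnit_det_of_posDef P.2)]

theorem eq_geodesicGenerator {B : Mat n} {P : SPD n} {W : Sym n}
    (h : B * P = (1 / 2 : ℝ) • (W : Mat n)) : B = geodesicGenerator P W := by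
  rw [geodesicGenerator, ← Matrix.smul_mul, ← h,
    mul_nonsing_inv_cancel_right _ _ (isUnit_det_of_posDef P.2)]

theorem geodesicGenerator_mul_add (P : SPD n) (U V : Sym n) :
    geodesicGenerator P U * V + V * (geodesicGenerator P U)ᵀ =
      (1 / 2 : ℝ) • (U * (P : Mat n)⁻¹ * V + V * (P : Mat n)⁻¹ * U) := by
  rw [transpose_geodesicGenerator, geodesicGenerator, Matrix.smul_mul, Matrix.mul_smul, smul_add,
    Matrix.mul_assoc (V : Mat n)]

theorem isParallel_metricAI_iff {γ : ℝ → SPD n} {u V : ℝ → Sym n} :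
    IsParallel metricAI γ u V ↔ ∀ t, HasDerivAt (fun s => (V s : Mat n))
      (geodesicGenerator (γ t) (u t) * V t + V t * (geodesicGenerator (γ t) (u t))ᵀ) t := by
  refine forall_congr' fun t => ?_
  simp only [metricAI_add_christoffel (γ t).2, ← geodesicGenerator_mul_add]
  constructor
  · rintro ⟨V', hV', hZ⟩
    have hsymm : (geodesicGenerator (γ t) (u t) * (V t : Mat n) +
        V t * (geodesicGenerator (γ t) (u t))ᵀ).IsSymm := by
      rw [IsSymm, transpose_add, transpose_mul, transpose_mul, transpose_transpose, (V t).2.eq,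
        add_comm]
    have hzero := eq_zero_of_forall_trace_inv_mul_eq_zero (γ t).2 (V'.2.sub hsymm)
      fun Z hZsymm => hZ ⟨Z, hZsymm⟩
    rwa [← sub_eq_zero.1 hzero]
  · intro h
    refine ⟨⟨_, isSymm_of_hasDerivAt h fun s => (V s).2⟩, h, fun Z => ?_⟩
    rw [sub_self, Matrix.mul_zero, Matrix.zero_mul, Matrix.zero_mul, trace_zero]

/-! ### Geodesics and parallel transport of the Affine-Invariant metric -/

/-- The flow of the linear differential equation `X' = B * X + X * Bᵀ`. -/
def lyapunovFlow (B : Mat n) (t : ℝ) (X : Mat n) : Mat n := exp (t • B) * X * (exp (t • B))ᵀ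

theorem lyapunovFlow_zero (B X : Mat n) : lyapunovFlow B 0 X = X := by
  simp [lyapunovFlow]

theorem isSymm_lyapunovFlow {X : Mat n} (hX : X.IsSymm) (B : Mat n) (t : ℝ) :
    (lyapunovFlow B t X).IsSymm :=
  isSymm_mul_mul_transpose hX _

theorem posDef_lyapunovFlow {P : Mat n} (hP : P.PosDef) (B : Mat n) (t : ℝ) :
    (lyapunovFlow B t P).PosDef :=
  posDef_mul_mul_transpose hP (Matrix.isUnit_exp _)

theorem commute_exp_smul (B : Mat n) (t : ℝ) : Commute B (exp (t • B)) :=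
  ((Commute.refl B).smul_right t).exp_right

theorem mul_lyapunovFlow (B X : Mat n) (t : ℝ) :
    B * lyapunovFlow B t X = lyapunovFlow B t (B * X) := by
  simp only [lyapunovFlow, ← Matrix.mul_assoc, (commute_exp_smul B t).eq]

theorem lyapunovFlow_mul_transpose (B X : Mat n) (t : ℝ) :
    lyapunovFlow B t X * Bᵀ = lyapunovFlow B t (X * Bᵀ) := by
  simp only [lyapunovFlow, Matrix.mul_assoc, ← transpose_mul, (commute_exp_smul B t).eq]

theorem lyapunovFlow_lyapunovFlow_neg (B X : Mat n) (t : ℝ) :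
    lyapunovFlow B t (lyapunovFlow (-B) t X) = X := by
  have hinv : exp (t • B) * exp (t • -B) = 1 := by
    rw [← Matrix.exp_add_of_commute _ _ (by simp), ← smul_add, add_neg_cancel, smul_zero, exp_zero]
  have hinv' := congrArg transpose hinv
  rw [transpose_mul, transpose_one] at hinv'
  simp only [lyapunovFlow, Matrix.mul_assoc, hinv', Matrix.mul_one]
  rw [← Matrix.mul_assoc, hinv, Matrix.one_mul]

theorem hasDerivAt_lyapunovFlow (B : Mat n) {X : ℝ → Mat n} {X' : Mat n} {t : ℝ}
    (hX : HasDerivAt X X' t) :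
    HasDerivAt (fun s => lyapunovFlow B s (X s))
      (lyapunovFlow B t (B * X t + X' + X t * Bᵀ)) t := by
  have hexp : HasDerivAt (fun s : ℝ => exp (s • B)) (exp (t • B) * B) t :=
    hasDerivAt_exp_smul_const B t
  refine ((hexp.mul hX).mul (hasDerivAt_transpose hexp)).congr_deriv ?_
  simp only [lyapunovFlow, Pi.mul_apply, transpose_mul, Matrix.mul_add, Matrix.add_mul,
    Matrix.mul_assoc]

theorem hasDerivAt_iff_eq_lyapunovFlow {B : Mat n} {X : ℝ → Mat n} :
    (∀ t, HasDerivAt X (B * X t + X t * Bᵀ) t) ↔ ∀ t, X t = lyapunovFlow B t (X 0) := by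
  constructor
  · intro hX t
    have hconst (t) : HasDerivAt (fun s => lyapunovFlow (-B) s (X s)) 0 t := by
      have h := hasDerivAt_lyapunovFlow (-B) (hX t)
      rwa [transpose_neg, Matrix.neg_mul, Matrix.mul_neg, neg_add_cancel_left, add_neg_cancel,
        lyapunovFlow, Matrix.mul_zero, Matrix.zero_mul] at h
    have h := is_const_of_deriv_eq_zero (fun t => (hconst t).differentiableAt)
      (fun t => (hconst t).deriv) t 0
    rw [lyapunovFlow_zero] at h
    rw [← h, lyapunovFlow_lyapunovFlow_neg]
  · intro hX t
    have h := hasDerivAt_lyapunovFlow B (hasDerivAt_const t (X 0))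
    rw [← funext hX] at h
    convert h using 1
    rw [hX t, mul_lyapunovFlow, lyapunovFlow_mul_transpose, add_zero]
    simp only [lyapunovFlow, Matrix.mul_add, Matrix.add_mul]

section Geodesic

variable {γ : ℝ → SPD n} {u V : ℝ → Sym n}

theorem geodesicGenerator_eq_of_isGeodesic (h : IsGeodesic metricAI γ u) (t : ℝ) :
    geodesicGenerator (γ t) (u t) = geodesicGenerator (γ 0) (u 0) := by
  have hconst (t) : HasDerivAt (fun s => (u s : Mat n) * (γ s : Mat n)⁻¹) 0 t := by
    refine ((isParallel_metricAI_iff.1 h.2 t).mul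
      (hasDerivAt_matrix_inv (h.1 t) (γ t).2.isUnit)).congr_deriv ?_
    rw [geodesicGenerator_mul_add, ← two_smul ℝ, smul_smul]
    simp [Matrix.mul_assoc]
  exact congrArg ((1 / 2 : ℝ) • ·) (is_const_of_deriv_eq_zero (fun t => (hconst t).differentiableAt)
    (fun t => (hconst t).deriv) t 0)

theorem isParallel_metricAI_iff_eq_lyapunovFlow (h : IsGeodesic metricAI γ u) :
    IsParallel metricAI γ u V ↔
      ∀ t, (V t : Mat n) = lyapunovFlow (geodesicGenerator (γ 0) (u 0)) t (V 0) := by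
  simp only [isParallel_metricAI_iff, geodesicGenerator_eq_of_isGeodesic h]
  exact hasDerivAt_iff_eq_lyapunovFlow

theorem isVelocity_iff : IsVelocity γ u ↔ ∀ t, HasDerivAt (fun s => (γ s : Mat n))
    (geodesicGenerator (γ t) (u t) * γ t + γ t * (geodesicGenerator (γ t) (u t))ᵀ) t := by
  simp only [geodesicGenerator_mul, mul_transpose_geodesicGenerator, ← add_smul, add_halves,
    one_smul, IsVelocity]

theorem eq_lyapunovFlow_of_isGeodesic (h : IsGeodesic metricAI γ u) (t : ℝ) :
    (γ t : Mat n) = lyapunovFlow (geodesicGenerator (γ 0) (u 0)) t (γ 0) := by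
  have hγ := isVelocity_iff.1 h.1
  simp only [geodesicGenerator_eq_of_isGeodesic h] at hγ
  exact hasDerivAt_iff_eq_lyapunovFlow.1 hγ t

theorem exists_isParallel_metricAI (h : IsGeodesic metricAI γ u) (X : Sym n) :
    ∃ V, IsParallel metricAI γ u V ∧ V 0 = X := by
  let V (t : ℝ) : Sym n :=
    ⟨lyapunovFlow (geodesicGenerator (γ 0) (u 0)) t X, isSymm_lyapunovFlow X.2 _ t⟩
  have hV : V 0 = X := Subtype.ext (lyapunovFlow_zero _ _)
  exact ⟨V, (isParallel_metricAI_iff_eq_lyapunovFlow h).2 fun t => by rw [hV], hV⟩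

end Geodesic

theorem exists_isGeodesic_metricAI (P : SPD n) (W : Sym n) :
    ∃ γ u, IsGeodesic metricAI γ u ∧ γ 0 = P ∧ u 0 = W := by
  set B := geodesicGenerator P W with hB
  let γ (t : ℝ) : SPD n := ⟨lyapunovFlow B t P, posDef_lyapunovFlow P.2 B t⟩
  let u (t : ℝ) : Sym n := ⟨lyapunovFlow B t W, isSymm_lyapunovFlow W.2 B t⟩
  have hγ0 : γ 0 = P := Subtype.ext (lyapunovFlow_zero B P)
  have hu0 : u 0 = W := Subtype.ext (lyapunovFlow_zero B W)
  have hgen (t) : geodesicGenerator (γ t) (u t) = B := by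
    refine (eq_geodesicGenerator ?_).symm
    simp only [γ, u, mul_lyapunovFlow, hB, geodesicGenerator_mul]
    simp only [lyapunovFlow, Matrix.mul_smul, Matrix.smul_mul]
  refine ⟨γ, u, ⟨isVelocity_iff.2 ?_, isParallel_metricAI_iff.2 ?_⟩, hγ0, hu0⟩
  · simp only [hgen]
    exact hasDerivAt_iff_eq_lyapunovFlow.2 fun t => by rw [hγ0]
  · simp only [hgen]
    exact hasDerivAt_iff_eq_lyapunovFlow.2 fun t => by rw [hu0]

theorem Exp_metricAI (P : SPD n) (W : Sym n) :
    (Exp metricAI P W : Mat n) = lyapunovFlow (geodesicGenerator P W) 1 P := by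
  obtain ⟨γ, u, hγ, h0, hu0, h1⟩ := exists_isGeodesic_Exp (exists_isGeodesic_metricAI P W)
  rw [← h1, eq_lyapunovFlow_of_isGeodesic hγ, h0, hu0]

/-! ### The gyro-structure of the Affine-Invariant metric -/

theorem isSymm_sqrt (P : Mat n) : (CFC.sqrt P).IsSymm :=
  isHermitian_iff_isSymm.1 (CFC.sqrt_nonneg P).isSelfAdjoint

theorem isUnit_sqrt {P : Mat n} (hP : P.PosDef) : IsUnit (CFC.sqrt P) :=
  hP.isStrictlyPositive.isUnit_cfcSqrt

theorem sqrt_mul_sqrt {P : Mat n} (hP : P.PosDef) : CFC.sqrt P * CFC.sqrt P = P :=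
  CFC.sqrt_mul_sqrt_self P hP.posSemidef.nonneg

theorem exp_half_smul_logm {P : Mat n} (hP : P.PosDef) :
    exp ((1 / 2 : ℝ) • logm P) = CFC.sqrt P := by
  refine (CFC.sqrt_unique ?_ (posDef_exp ((isSymm_logm P).smul _)).posSemidef.nonneg).symm
  rw [← Matrix.exp_add_of_commute _ _ (Commute.refl _), ← add_smul, add_halves, one_smul,
    exp_logm hP]

theorem lyapunovFlow_half_smul_logm {P : Mat n} (hP : P.PosDef) (X : Mat n) :
    lyapunovFlow ((1 / 2 : ℝ) • logm P) 1 X = CFC.sqrt P * X * CFC.sqrt P := by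
  rw [lyapunovFlow, one_smul, exp_half_smul_logm hP, (isSymm_sqrt P).eq]

theorem geodesicGenerator_one (W : Sym n) :
    geodesicGenerator (one n) W = (1 / 2 : ℝ) • (W : Mat n) := by
  rw [geodesicGenerator, one, inv_one, Matrix.mul_one]

theorem lyapunovFlow_half_smul_one {W : Mat n} (hW : W.IsSymm) :
    lyapunovFlow ((1 / 2 : ℝ) • W) 1 1 = exp W := by
  have h := lyapunovFlow_half_smul_logm (posDef_exp hW) 1
  rwa [logm_exp hW, Matrix.mul_one, sqrt_mul_sqrt (posDef_exp hW)] at h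

theorem geodesic_from_one {γ : ℝ → SPD n} {u : ℝ → Sym n} (h : IsGeodesic metricAI γ u)
    (h0 : γ 0 = one n) : (γ 1 : Mat n) = exp (u 0 : Mat n) := by
  rw [eq_lyapunovFlow_of_isGeodesic h, h0, geodesicGenerator_one]
  exact lyapunovFlow_half_smul_one (u 0).2

theorem Exp_one_metricAI (W : Sym n) : (Exp metricAI (one n) W : Mat n) = exp (W : Mat n) := by
  obtain ⟨γ, u, hγ, h0, hu0, h1⟩ := exists_isGeodesic_Exp (exists_isGeodesic_metricAI (one n) W)
  rw [← h1, geodesic_from_one hγ h0, hu0]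

theorem Log_one_metricAI (Q : SPD n) : (Log metricAI (one n) Q : Mat n) = logm (Q : Mat n) := by
  have hExp : Exp metricAI (one n) (Log metricAI (one n) Q) = Q :=
    Exp_Log ⟨⟨logm Q, isSymm_logm _⟩, Subtype.ext ((Exp_one_metricAI _).trans (exp_logm Q.2))⟩
  conv_rhs => rw [← hExp, Exp_one_metricAI, logm_exp (Log metricAI (one n) Q).2]

theorem transport_one_metricAI (P : SPD n) (W : Sym n) :
    (transport metricAI (one n) P W : Mat n) = CFC.sqrt (P : Mat n) * W * CFC.sqrt (P : Mat n) := by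
  obtain ⟨γ₀, u₀, hγ₀, h₀, hu₀⟩ := exists_isGeodesic_metricAI (one n) ⟨logm P, isSymm_logm _⟩
  obtain ⟨V₀, hV₀⟩ := exists_isParallel_metricAI hγ₀ W
  have h₁ : γ₀ 1 = P := Subtype.ext (by rw [geodesic_from_one hγ₀ h₀, hu₀, exp_logm P.2])
  obtain ⟨γ, u, V, hγ, h0, h1, hV, hV0, hV1⟩ :=
    exists_isParallel_transport ⟨γ₀, u₀, V₀, hγ₀, h₀, h₁, hV₀⟩
  have hu0 : (u 0 : Mat n) = logm P := by
    rw [← h1, geodesic_from_one hγ h0, logm_exp (u 0).2]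
  rw [← hV1, (isParallel_metricAI_iff_eq_lyapunovFlow hγ).1 hV 1, h0, hV0, geodesicGenerator_one,
    hu0, lyapunovFlow_half_smul_logm P.2]

theorem oplus_ai (P Q : SPD n) :
    (oplus .ai P Q : Mat n) = CFC.sqrt (P : Mat n) * Q * CFC.sqrt (P : Mat n) := by
  set S := CFC.sqrt (P : Mat n) with hS
  have hunit : IsUnit S := isUnit_sqrt P.2
  have hdet : IsUnit S.det := (isUnit_iff_isUnit_det S).1 hunit
  have hsymm : S.IsSymm := isSymm_sqrt _
  have hSS : S * S = P := sqrt_mul_sqrt P.2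
  have hinv : (P : Mat n)⁻¹ = S⁻¹ * S⁻¹ := by rw [← hSS, Matrix.mul_inv_rev]
  have hgen : geodesicGenerator P (transport metricAI (one n) P (Log metricAI (one n) Q)) =
      S * ((1 / 2 : ℝ) • logm Q) * S⁻¹ := by
    rw [geodesicGenerator, transport_one_metricAI, Log_one_metricAI, hinv, ← hS,
      ← Matrix.mul_assoc, mul_nonsing_inv_cancel_right _ _ hdet, Matrix.mul_smul, Matrix.smul_mul]
  change (Exp metricAI P (transport metricAI (one n) P (Log metricAI (one n) Q)) : Mat n) = _
  rw [Exp_metricAI, hgen, lyapunovFlow, one_smul, Matrix.exp_conj _ _ hunit,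
    exp_half_smul_logm Q.2, transpose_mul, transpose_mul, (isSymm_inv hsymm).eq, hsymm.eq,
    (isSymm_sqrt _).eq, ← hSS]
  simp only [Matrix.mul_assoc, nonsing_inv_mul_cancel_left _ _ hdet,
    mul_nonsing_inv_cancel_left _ _ hdet]
  rw [← Matrix.mul_assoc (CFC.sqrt (Q : Mat n)), sqrt_mul_sqrt Q.2]

theorem oplus_ai_eq_one_iff {X P : SPD n} : oplus .ai X P = one n ↔ (X * P : Mat n) = 1 := by
  rw [← Subtype.coe_inj, oplus_ai, one, mul_eq_one_comm, ← Matrix.mul_assoc, sqrt_mul_sqrt X.2]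

theorem ominus_ai_oplus (P : SPD n) : oplus .ai (ominus .ai P) P = one n :=
  ominus_oplus ⟨⟨(P : Mat n)⁻¹, P.2.inv⟩,
    oplus_ai_eq_one_iff.2 (nonsing_inv_mul _ (isUnit_det_of_posDef P.2))⟩

theorem ominus_ai (P : SPD n) : (ominus .ai P : Mat n) = (P : Mat n)⁻¹ :=
  (inv_eq_left_inv (oplus_ai_eq_one_iff.1 (ominus_ai_oplus P))).symm

/-- Conjugation of SPD matrices by an orthogonal matrix. -/
def orthogonalConj (O : orthogonalGroup (Fin n) ℝ) (P : SPD n) : SPD n :=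
  ⟨Unitary.conjStarAlgAut ℝ (Mat n) O P,
    posDef_mul_mul_transpose P.2 (Unitary.toUnits O).isUnit⟩

theorem sqrt_orthogonalConj (O : orthogonalGroup (Fin n) ℝ) (P : SPD n) :
    CFC.sqrt (orthogonalConj O P : Mat n) =
      Unitary.conjStarAlgAut ℝ (Mat n) O (CFC.sqrt (P : Mat n)) :=
  CFC.sqrt_unique (by rw [← map_mul, sqrt_mul_sqrt P.2]; rfl)
    (map_nonneg (Unitary.conjStarAlgAut ℝ (Mat n) O) (CFC.sqrt_nonneg _))

theorem logm_orthogonalConj (O : orthogonalGroup (Fin n) ℝ) (P : SPD n) :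
    logm (orthogonalConj O P : Mat n) = Unitary.conjStarAlgAut ℝ (Mat n) O (logm (P : Mat n)) := by
  have hexp : exp (Unitary.conjStarAlgAut ℝ (Mat n) O (logm (P : Mat n))) = orthogonalConj O P := by
    refine (Matrix.exp_units_conj (Unitary.toUnits O) (logm (P : Mat n))).trans ?_
    rw [exp_logm P.2]
    rfl
  rw [← hexp]
  exact logm_exp (isSymm_mul_mul_transpose (isSymm_logm _) _)

theorem oplus_orthogonalConj (O : orthogonalGroup (Fin n) ℝ) (P Q : SPD n) :
    oplus .ai (orthogonalConj O P) (orthogonalConj O Q) = orthogonalConj O (oplus .ai P Q) :=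
  Subtype.ext (by
    rw [oplus_ai, sqrt_orthogonalConj]
    simp only [orthogonalConj, ← map_mul, oplus_ai])

theorem ominus_orthogonalConj (O : orthogonalGroup (Fin n) ℝ) (P : SPD n) :
    ominus .ai (orthogonalConj O P) = orthogonalConj O (ominus .ai P) := Subtype.ext (by
  rw [ominus_ai]
  refine inv_eq_left_inv ?_
  simp only [orthogonalConj, ← map_mul]
  rw [oplus_ai_eq_one_iff.1 (ominus_ai_oplus P), map_one])

theorem spdNorm_ai (P : SPD n) :
    spdNorm .ai P = √(logm (P : Mat n) * logm (P : Mat n)).trace := by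
  have h : spdInner .ai P P = (logm (P : Mat n) * logm (P : Mat n)).trace := by
    change metricAI (1 : Mat n) (Log metricAI (one n) P) (Log metricAI (one n) P) = _
    rw [Log_one_metricAI, metricAI, inv_one, Matrix.one_mul, Matrix.mul_one]
  rw [spdNorm, h]

theorem spdNorm_orthogonalConj (O : orthogonalGroup (Fin n) ℝ) (P : SPD n) :
    spdNorm .ai (orthogonalConj O P) = spdNorm .ai P := by
  rw [spdNorm_ai, logm_orthogonalConj, ← map_mul, Unitary.conjStarAlgAut_apply, trace_mul_comm,
    ← Matrix.mul_assoc, Unitary.coe_star_mul_self, Matrix.one_mul, spdNorm_ai]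

theorem isGyroisometry_orthogonalConj (O : orthogonalGroup (Fin n) ℝ) :
    IsGyroisometry .ai (orthogonalConj O) := fun P Q => by
  rw [gyrodist, ominus_orthogonalConj, oplus_orthogonalConj, spdNorm_orthogonalConj, gyrodist]

theorem exists_gyr_ai_eq_orthogonalConj (P Q : SPD n) :
    ∃ O : orthogonalGroup (Fin n) ℝ, gyr .ai P Q = orthogonalConj O := by
  set T := ominus .ai (oplus .ai P Q) with hT
  let O : Mat n := CFC.sqrt (T : Mat n) * CFC.sqrt (P : Mat n) * CFC.sqrt (Q : Mat n)
  have htranspose : Oᵀ = CFC.sqrt (Q : Mat n) * CFC.sqrt (P : Mat n) * CFC.sqrt (T : Mat n) := by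
    rw [transpose_mul, transpose_mul, (isSymm_sqrt _).eq, (isSymm_sqrt _).eq, (isSymm_sqrt _).eq,
      Matrix.mul_assoc]
  have hO : O * Oᵀ = 1 := calc
    O * Oᵀ = CFC.sqrt (T : Mat n) * (CFC.sqrt (P : Mat n) *
        (CFC.sqrt (Q : Mat n) * CFC.sqrt (Q : Mat n)) * CFC.sqrt (P : Mat n)) *
        CFC.sqrt (T : Mat n) := by rw [htranspose]; simp only [O, Matrix.mul_assoc]
    _ = oplus .ai T (oplus .ai P Q) := by rw [sqrt_mul_sqrt Q.2, ← oplus_ai, ← oplus_ai]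
    _ = 1 := congrArg Subtype.val (ominus_ai_oplus _)
  refine ⟨⟨O, (mem_orthogonalGroup_iff (Fin n) ℝ).2 hO⟩, funext fun R => Subtype.ext ?_⟩
  rw [gyr, ← hT, oplus_ai T, oplus_ai P (oplus .ai Q R), oplus_ai Q R]
  change _ = O * R * Oᵀ
  rw [htranspose]
  simp only [O, Matrix.mul_assoc]

end SPDGyro

end

theorem mainTheorem10 (n : ℕ) (g : SPDGyro.Geometry) (P Q : SPDGyro.SPD n) :
    SPDGyro.IsGyroisometry g (SPDGyro.gyr g P Q) := by
  cases g with
  | le => exact (SPDGyro.isFlat_logChart n).isGyroisometry_gyr (g := .le) P Q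
  | lc => exact (SPDGyro.isFlat_logCholeskyChart n).isGyroisometry_gyr (g := .lc) P Q
  | ai =>
    obtain ⟨O, hgyr⟩ := SPDGyro.exists_gyr_ai_eq_orthogonalConj P Q
    rw [hgyr]
    exact SPDGyro.isGyroisometry_orthogonalConj O
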